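/- Setting. One item is sold to $n$ bidders with a common capacity $C\in(0,\infty)$: a bidder with wealth $w$ has utility $u_C(w)=\min(w,C)$. The values $v_1,\dots,v_n$ are independent, $v_i\sim F_i$, where $F_i$ (not necessarily identical) is carried by an interval $T_i\subseteq[0,\infty)$ and has a positive density $f_i$ on $T_i$, except that the largest element of $T_i$, if there is one, may carry an atom. $F_i$ is regular: the virtual value $\varphi_i(v)=v-\frac{1-F_i(v)}{f_i(v)}$ (which is $h$ at the largest element $h$ of $T_i$, if there is one) is nondecreasing on $T_i$. An auction for bidders with utility function $u$ is a (possibly randomized) direct mechanism that serves at most one bidder, in which losers pay $0$, winners pay at most their reported value (payments may be negative), and which is Bayesian incentive compatible: for all $i$ and all $v,z\in T_i$, bidder $i$ with value $v$ maximizes her expected utility $\mathbf E[u(v x_i-p_i)]$ over reports $z$ by reporting $v$ when the others report truthfully. Its revenue is the expected total payment under truthful reports (in $[-\infty,\infty]$). Two auctions. The risk-neutral optimal auction $\mathrm{RN}$ serves the bidder with the highest nonnegative virtual value and charges her the infimum of the types with which she would still win. The capacitated second-price auction $\mathrm{CSP}$ serves the highest bidder and charges her the maximum of the second-highest bid ($0$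 if there is none) and her bid minus $C$. Ties are broken by index. Claim. Both are auctions for capacitated bidders (utility function $u_C$). $\mathrm{RN}$ is also an auction for risk-neutral bidders and, if the values have finite means, its revenue is the maximum over all auctions for risk-neutral bidders. Every auction $M$ for capacitated bidders satisfies $$\mathrm{Rev}(M)\le 3\max\{\mathrm{Rev}(\mathrm{RN}),\mathrm{Rev}(\mathrm{CSP})\},$$ i.e. the better of $\mathrm{RN}$ and $\mathrm{CSP}$ is a 3-approximation to the optimal revenue for capacitated bidders. -/

import Mathlib

open MeasureTheory ProbabilityTheory
open scoped ENNReal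

noncomputable section

/-- Expectation of a real function with values in `[-∞, ∞]`: the expectation of the positive part
minus the expectation of the negative part. If both parts have infinite expectation the value is
`⊥`. No integrability is needed to speak about it. -/
def eexpect {α : Type*} [MeasurableSpace α] (μ : Measure α) (f : α → ℝ) : EReal :=
  ((∫⁻ x, ENNReal.ofReal (f x) ∂μ : ℝ≥0∞) : EReal)
    - ((∫⁻ x, ENNReal.ofReal (-f x) ∂μ : ℝ≥0∞) : EReal)

/-- The prior distribution of the private value of one bidder: a probability law carried by an
interval `types` of nonnegative values (bounded or not, with or without its end points), which has
a positive density at all types but possibly the largest one. At the largest type, if there is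
one, the law may have an atom (as the equal revenue distribution on `[1, h]` has at `h`). -/
structure ValueDistribution where
  law : Measure ℝ
  types : Set ℝ
  density : ℝ → ℝ
  isProb : IsProbabilityMeasure law
  types_nonneg : ∀ v ∈ types, 0 ≤ v
  types_ordConnected : types.OrdConnected
  law_types : ∀ᵐ v ∂law, v ∈ types
  measurable_density : Measurable density
  density_pos : ∀ v ∈ types, (∃ w ∈ types, v < w) → 0 < density v
  law_eq_density :
    law.restrict {v | v ∈ types ∧ ∃ w ∈ types, v < w} =
      (volume.restrict {v | v ∈ types ∧ ∃ w ∈ types, v < w}).withDensity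
        (fun v => ENNReal.ofReal (density v))

namespace ValueDistribution

/-- The virtual value `φ(v) = v - (1 - F(v)) / f(v)`. At the largest type `h` (if there is one)
`F(h) = 1`, so that `φ(h) = h`. -/
def virtualValue (F : ValueDistribution) (v : ℝ) : ℝ :=
  v - (1 - cdf F.law v) / F.density v

/-- A distribution is regular if its virtual value is monotone (nondecreasing) on the types. -/
def IsRegular (F : ValueDistribution) : Prop :=
  MonotoneOn F.virtualValue F.types

end ValueDistribution

/-- A (direct, single-item) mechanism for `n` bidders with random seeds in `R`: given the seed and
the reports, at most one bidder is served, and every bidder makes a real payment. -/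
structure Mechanism (n : ℕ) (R : Type*) [MeasurableSpace R] where
  seedLaw : Measure R
  isProb : IsProbabilityMeasure seedLaw
  winner : R → (Fin n → ℝ) → Option (Fin n)
  pay : R → (Fin n → ℝ) → Fin n → ℝ

namespace Mechanism

variable {n : ℕ} {R : Type*} [MeasurableSpace R]

/-- The ex post allocation of bidder `i`: `1` if she is served and `0` otherwise. -/
def alloc (M : Mechanism n R) (r : R) (b : Fin n → ℝ) (i : Fin n) : ℝ :=
  if M.winner r b = some i then 1 else 0

/-- The joint law of the seed of the mechanism and of the (independent) values of the bidders. -/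
def jointLaw (M : Mechanism n R) (F : Fin n → ValueDistribution) : Measure (R × (Fin n → ℝ)) :=
  haveI := fun i => (F i).isProb
  haveI := M.isProb
  M.seedLaw.prod (Measure.pi fun i => (F i).law)

/-- Allocations and payments depend measurably on seed and reports. -/
def IsMeasurable (M : Mechanism n R) : Prop :=
  ∀ i, Measurable (fun q : R × (Fin n → ℝ) => M.alloc q.1 q.2 i) ∧
    Measurable (fun q : R × (Fin n → ℝ) => M.pay q.1 q.2 i)

/-- Losers have no payments and winners pay at most their reported values. -/
def IsExPostIR (M : Mechanism n R) (F : Fin n → ValueDistribution) : Prop :=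
  ∀ (r : R) (b : Fin n → ℝ), (∀ j, b j ∈ (F j).types) → ∀ i,
    (M.winner r b = some i → M.pay r b i ≤ b i) ∧ (M.winner r b ≠ some i → M.pay r b i = 0)

/-- The expected utility, for the utility function `u` of wealth, of bidder `i` with value `v` who
reports `z` while the other bidders report their values. -/
def interimUtility (M : Mechanism n R) (F : Fin n → ValueDistribution) (u : ℝ → ℝ)
    (i : Fin n) (v z : ℝ) : EReal :=
  eexpect (M.jointLaw F) fun q =>
    u (v * M.alloc q.1 (Function.update q.2 i z) i - M.pay q.1 (Function.update q.2 i z) i)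

/-- Bayesian incentive compatibility: truthtelling is a Bayes-Nash equilibrium. -/
def IsBIC (M : Mechanism n R) (F : Fin n → ValueDistribution) (u : ℝ → ℝ) : Prop :=
  ∀ i, ∀ v ∈ (F i).types, ∀ z ∈ (F i).types,
    M.interimUtility F u i v z ≤ M.interimUtility F u i v v

/-- The mechanisms under consideration for bidders with utility function `u` of wealth. -/
structure IsAuction (M : Mechanism n R) (F : Fin n → ValueDistribution) (u : ℝ → ℝ) : Prop where
  measurable : M.IsMeasurable
  exPostIR : M.IsExPostIR F
  bic : M.IsBIC F u

/-- The expected total payment, under truthful reports. -/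
def revenue (M : Mechanism n R) (F : Fin n → ValueDistribution) : EReal :=
  eexpect (M.jointLaw F) fun q => ∑ i, M.pay q.1 q.2 i

/-- A mechanism that uses no randomness. -/
def deterministic (winner : (Fin n → ℝ) → Option (Fin n)) (pay : (Fin n → ℝ) → Fin n → ℝ) :
    Mechanism n Unit where
  seedLaw := Measure.dirac ()
  isProb := inferInstance
  winner := fun _ => winner
  pay := fun _ => pay

end Mechanism

/-- The capacitated utility function with capacity `C`. -/
def capUtility (C w : ℝ) : ℝ := min w C

/-- The risk-neutral utility function. -/
def riskNeutralUtility (w : ℝ) : ℝ := w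

/-- Bidder `i` has the highest score, it is not negative, and she has the smallest index among the
bidders with the highest score. -/
def HasTopScore {n : ℕ} (s : Fin n → ℝ) (i : Fin n) : Prop :=
  0 ≤ s i ∧ ∀ j, s j ≤ s i ∧ (j < i → s j < s i)

open Classical in
/-- The bidder with the highest nonnegative score, ties broken by index; nobody if all scores are
negative. -/
def topBidder {n : ℕ} (s : Fin n → ℝ) : Option (Fin n) :=
  if h : ∃ i, HasTopScore s i then some h.choose else none

theorem HasTopScore.unique {n : ℕ} {s : Fin n → ℝ} {i j : Fin n} (hi : HasTopScore s i) (hj : HasTopScore s j) :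
    i = j := by
  rcases lt_trichotomy i j with h | h | h
  · exact absurd ((hj.2 i).2 h) (not_lt.2 (hi.2 j).1)
  · exact h
  · exact absurd ((hi.2 j).2 h) (not_lt.2 (hj.2 i).1)

theorem topBidder_eq_some_iff {n : ℕ} (s : Fin n → ℝ) (i : Fin n) :
    topBidder s = some i ↔ HasTopScore s i := by
  unfold topBidder
  split_ifs with h
  · rw [Option.some_inj]
    exact ⟨fun e => e ▸ h.choose_spec, fun hi => h.choose_spec.unique hi⟩
  · simp only [false_iff]
    exact fun hi => h ⟨i, hi⟩

/-- The virtual values of a profile of reports. -/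
def virtualScores {n : ℕ} (F : Fin n → ValueDistribution) (b : Fin n → ℝ) (i : Fin n) : ℝ :=
  (F i).virtualValue (b i)

/-- The risk-neutral revenue-optimal auction for independent regular values: it serves the bidder
with the highest nonnegative virtual value and charges her the infimum of the types with which she
would still win against the same reports of the others. For identical distributions this is the
second-price auction with the monopoly reserve price. -/
def myersonAuction {n : ℕ} (F : Fin n → ValueDistribution) : Mechanism n Unit :=
  Mechanism.deterministic
    (fun b => topBidder (virtualScores F b))
    (fun b i =>
      if topBidder (virtualScores F b) = some i then
        sInf {z | z ∈ (F i).types ∧ HasTopScore (virtualScores F (Function.update b i z)) i}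
      else 0)

/-- The highest bid of the bidders other than `i`, and `0` if there are none (bids are
nonnegative). -/
def highestOther {n : ℕ} (b : Fin n → ℝ) (i : Fin n) : ℝ :=
  (Finset.univ.erase i).fold max 0 b

/-- The capacitated second-price auction: the highest bidder is served and pays the maximum of the
second-highest bid and her own bid less the capacity. -/
def capacitatedSecondPrice (n : ℕ) (C : ℝ) : Mechanism n Unit :=
  Mechanism.deterministic
    (fun b => topBidder b)
    (fun b i => if topBidder b = some i then max (highestOther b i) (b i - C) else 0)

end

/-! For a bidder in an auction `M` for capacitated bidders, let x(v) be her interim winning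
probability and U(v) her interim truthful utility, capped at C. Capping only lowers utility, so her
interim payment is at most v x(v) - U(v); it suffices to bound this from above.

A winner of type z with wealth w in [0, C] who turns out to be worth d more gets min(w + d, C). This
is concave in w, so it lies above the chord w + (1 - w/C) min(d, C). The chord is linear in the
allocation and the capped wealth, so taking expectations turns incentive compatibility against
underreporting into U(z) + g(z) min(v - z, C) ≤ U(v), where g = x - U/C ≥ 0 (`cappedUtility_bounds`,
`IsAuction.truthfulUtility_add_le`). This is used twice, for v - z small (so that U grows at least
at rate g) and for the full step from z to v. Integrating the sum of both bounds over z gives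
`mul_integral_le_of_add_mul_min_le`, which rearranges to v x - U ≤ (v y(v) - ∫₀ᵛ y) + (v - C)⁺ x(v),
with y = x + U/C.

The bracket is the threshold payment for the allocation y, so its mean is E[φ y]
(`integral_virtualValue_mul`). Since U ≤ C x, y ≤ 2x, and the mean is at most 2 E[φ⁺ x]. Summed over
bidders, E[φ⁺ x] is at most the revenue of RN, which takes the highest nonnegative virtual value
pointwise. The excess terms sum to at most the revenue of CSP, whose winner pays at least (vᵢ - C)⁺
for every i. Together this is 2 + 1 = 3.

If CSP has infinite revenue the bound is trivial; otherwise its payments dominate each value up to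
C, so all means are finite. Risk-neutral optimality runs through the same envelope and virtual
surplus lemmas with y = x. -/

noncomputable section

/-! ### Envelope inequalities on the real line -/

section RealAnalysis

theorem intervalIntegrable_of_bounded {g : ℝ → ℝ} {a b B : ℝ} (hab : a ≤ b) (hg : Measurable g)
    (h0 : ∀ z ∈ Set.Icc a b, 0 ≤ g z) (hB : ∀ z ∈ Set.Icc a b, g z ≤ B) :
    IntervalIntegrable g volume a b := by
  rw [intervalIntegrable_iff_integrableOn_Icc_of_le hab]
  refine Measure.integrableOn_of_bounded (M := B) (by simp) hg.aestronglyMeasurable ?_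
  filter_upwards [ae_restrict_mem measurableSet_Icc] with z hz
  rw [Real.norm_eq_abs, abs_of_nonneg (h0 z hz)]
  exact hB z hz

/-- A function whose increments dominate `g s * (t - s)` for close `s ≤ t` grows at least by the
integral of `g`. -/
theorem integral_le_sub_of_add_mul_min_le {U g : ℝ → ℝ} {a b B C : ℝ} (hab : a ≤ b) (hC : 0 < C)
    (hg : Measurable g) (h0 : ∀ z ∈ Set.Icc a b, 0 ≤ g z) (hB : ∀ z ∈ Set.Icc a b, g z ≤ B)
    (h : ∀ s t, a ≤ s → s ≤ t → t ≤ b → U s + g s * min (t - s) C ≤ U t) :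
    ∫ z in a..b, g z ≤ U b - U a := by
  have hB0 : 0 ≤ B := (h0 a ⟨le_rfl, hab⟩).trans (hB a ⟨le_rfl, hab⟩)
  have hmono : MonotoneOn U (Set.Icc a b) := by
    intro s hs t ht hst
    have h1 := h s t hs.1 hst ht.2
    have h2 : 0 ≤ g s * min (t - s) C :=
      mul_nonneg (h0 s hs) (le_min (sub_nonneg.2 hst) hC.le)
    linarith
  rcases hab.eq_or_lt with rfl | hlt
  · simp
  -- No regularity of `U` beyond monotonicity is available, so `g` is compared with the forward
  -- difference quotient of step `δ ≤ C`, whose integral is controlled by the increment of `U`. The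
  -- quotient leaves `[a, b]` on the last piece of length `δ`, which costs at most `B * δ`.
  have key : ∀ δ, 0 < δ → δ ≤ C → δ ≤ b - a → ∫ z in a..b, g z ≤ U b - U a + B * δ := by
    intro δ hδ hδC hδb
    have hbd : a ≤ b - δ := by linarith
    have i1 : IntervalIntegrable g volume a (b - δ) :=
      intervalIntegrable_of_bounded hbd hg (fun z hz => h0 z ⟨hz.1, by linarith [hz.2]⟩)
        (fun z hz => hB z ⟨hz.1, by linarith [hz.2]⟩)
    have i2 : IntervalIntegrable g volume (b - δ) b :=
      intervalIntegrable_of_bounded (by linarith) hg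
        (fun z hz => h0 z ⟨by linarith [hz.1], hz.2⟩)
        (fun z hz => hB z ⟨by linarith [hz.1], hz.2⟩)
    rw [← intervalIntegral.integral_add_adjacent_intervals i1 i2]
    have hm' : MonotoneOn U (Set.Icc a (b - δ + δ)) := by simpa using hmono
    have h1 := hm'.intervalIntegral_slope_le hbd hδ.le
    have h2 : ∫ z in a..(b - δ), g z ≤ ∫ z in a..(b - δ), slope U z (z + δ) := by
      refine intervalIntegral.integral_mono_on hbd i1 (hm'.intervalIntegrable_slope hbd hδ.le) ?_
      intro z hz
      have := h z (z + δ) hz.1 (by linarith) (by linarith [hz.2])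
      rw [add_sub_cancel_left, min_eq_left hδC] at this
      rw [slope_def_field, add_sub_cancel_left, le_div_iff₀ hδ]
      linarith
    have h3 : ∫ z in (b - δ)..b, g z ≤ ∫ z in (b - δ)..b, B :=
      intervalIntegral.integral_mono_on (by linarith) i2 (by simp)
        (fun z hz => hB z ⟨by linarith [hz.1], hz.2⟩)
    rw [sub_add_cancel] at h1
    simp only [intervalIntegral.integral_const, smul_eq_mul] at h3
    linarith
  refine le_of_forall_pos_le_add fun ε hε => ?_
  set δ := min (min C (b - a)) (ε / (B + 1)) with hδ
  have hδ0 : 0 < δ := lt_min (lt_min hC (by linarith)) (by positivity)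
  have h1 := key δ hδ0 ((min_le_left _ _).trans (min_le_left _ _))
    ((min_le_left _ _).trans (min_le_right _ _))
  have h2 : δ * (B + 1) ≤ ε := (le_div_iff₀ (by linarith)).1 (min_le_right _ _)
  linarith

/-- Tonelli on the set z < v. The strict inequality produces `μ (Set.Ioi z)`, which is 1 - F(z) even
in the presence of atoms. -/
theorem lintegral_setLIntegral_Iio (μ ν : Measure ℝ) [SFinite μ] [SFinite ν] {y : ℝ → ℝ≥0∞}
    (hy : Measurable y) :
    ∫⁻ v, ∫⁻ z in Set.Iio v, y z ∂ν ∂μ = ∫⁻ z, y z * μ (Set.Ioi z) ∂ν := by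
  have h1 : ∀ v, ∫⁻ z in Set.Iio v, y z ∂ν
      = ∫⁻ z, {p : ℝ × ℝ | p.2 < p.1}.indicator (fun p => y p.2) (v, z) ∂ν := by
    intro v
    rw [← lintegral_indicator measurableSet_Iio]
    rfl
  have hms : MeasurableSet {p : ℝ × ℝ | p.2 < p.1} := measurableSet_lt measurable_snd measurable_fst
  simp_rw [h1]
  rw [lintegral_lintegral_swap
    (f := fun v z => {p : ℝ × ℝ | p.2 < p.1}.indicator (fun p => y p.2) (v, z))
    ((hy.comp measurable_snd).indicator hms).aemeasurable]
  refine lintegral_congr fun z => ?_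
  rw [← lintegral_indicator_const measurableSet_Ioi]
  rfl

/-- Fubini on the triangle z < t: the point t is counted by all z in (0, t), a set of length t. -/
theorem integral_integral_eq_integral_mul {g : ℝ → ℝ} {v B : ℝ} (hv : 0 ≤ v) (hg : Measurable g)
    (h0 : ∀ z ∈ Set.Icc 0 v, 0 ≤ g z) (hB : ∀ z ∈ Set.Icc 0 v, g z ≤ B) :
    ∫ z in (0 : ℝ)..v, ∫ t in z..v, g t = ∫ t in (0 : ℝ)..v, t * g t := by
  have hms : MeasurableSet {p : ℝ × ℝ | p.1 < p.2} := measurableSet_lt measurable_fst measurable_snd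
  have h1 : ∀ z ∈ Set.Icc 0 v, ∫ t in z..v, g t
      = ∫ t in (0 : ℝ)..v, {p : ℝ × ℝ | p.1 < p.2}.indicator (fun p => g p.2) (z, t) := by
    intro z hz
    rw [intervalIntegral.integral_of_le hz.2, intervalIntegral.integral_of_le hv]
    have : ∀ t, {p : ℝ × ℝ | p.1 < p.2}.indicator (fun p => g p.2) (z, t)
        = (Set.Ioi z).indicator g t := fun t => rfl
    simp_rw [this]
    rw [setIntegral_indicator measurableSet_Ioi]
    congr 2
    ext t
    simp only [Set.mem_Ioc, Set.mem_inter_iff, Set.mem_Ioi]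
    have := hz.1
    grind
  rw [intervalIntegral.integral_congr (g := fun z => ∫ t in (0 : ℝ)..v,
    {p : ℝ × ℝ | p.1 < p.2}.indicator (fun p => g p.2) (z, t))
    (fun z hz => h1 z (by rwa [Set.uIcc_of_le hv] at hz))]
  rw [intervalIntegral_intervalIntegral_swap]
  · refine intervalIntegral.integral_congr fun t ht => ?_
    rw [Set.uIcc_of_le hv] at ht
    have : ∀ z, {p : ℝ × ℝ | p.1 < p.2}.indicator (fun p => g p.2) (z, t)
        = (Set.Iio t).indicator (fun _ => g t) z := fun z => rfl
    simp_rw [this]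
    rw [intervalIntegral.integral_of_le hv, setIntegral_indicator measurableSet_Iio]
    have : Set.Ioc 0 v ∩ Set.Iio t = Set.Ioo 0 t := by
      ext z
      simp only [Set.mem_inter_iff, Set.mem_Ioc, Set.mem_Iio, Set.mem_Ioo]
      have := ht.2
      grind
    simp [this, ht.1]
  · rw [Set.uIoc_of_le hv]
    refine Measure.integrableOn_of_bounded (M := B) ?_
      ((hg.comp measurable_snd).indicator hms).aestronglyMeasurable ?_
    · rw [Measure.volume_eq_prod, Measure.prod_prod]
      exact ENNReal.mul_ne_top (by simp) (by simp)
    · filter_upwards [ae_restrict_mem (measurableSet_Ioc.prod measurableSet_Ioc)] with p hp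
      have h2 : p.2 ∈ Set.Icc 0 v := ⟨hp.2.1.le, hp.2.2⟩
      have hB0 : 0 ≤ B := (h0 _ h2).trans (hB _ h2)
      change |{p : ℝ × ℝ | p.1 < p.2}.indicator (fun p => g p.2) p| ≤ B
      by_cases hlt : p.1 < p.2
      · rw [Set.indicator_of_mem (show p ∈ {p : ℝ × ℝ | p.1 < p.2} from hlt),
          abs_of_nonneg (h0 _ h2)]
        exact hB _ h2
      · rw [Set.indicator_of_notMem (show p ∉ {p : ℝ × ℝ | p.1 < p.2} from hlt)]
        simpa

/-- The key inequality for the truncated utility `U` of a capacitated bidder. -/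
theorem mul_integral_le_of_add_mul_min_le {U g : ℝ → ℝ} {v B C : ℝ} (hv : 0 ≤ v) (hC : 0 < C)
    (hg : Measurable g) (h0 : ∀ z ∈ Set.Icc 0 v, 0 ≤ g z) (hB : ∀ z ∈ Set.Icc 0 v, g z ≤ B)
    (hU : 0 ≤ U 0)
    (h : ∀ s t, 0 ≤ s → s ≤ t → t ≤ v → U s + g s * min (t - s) C ≤ U t) :
    C * ∫ z in (0 : ℝ)..v, g z ≤ max (C - v) 0 * U v + 2 * v * U v - 2 * ∫ z in (0 : ℝ)..v, U z := by
  have hsub : ∀ s, 0 ≤ s → s ≤ v → ∫ z in s..v, g z ≤ U v - U s := fun s hs hsv =>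
    integral_le_sub_of_add_mul_min_le hsv hC hg (fun z hz => h0 z ⟨hs.trans hz.1, hz.2⟩)
      (fun z hz => hB z ⟨hs.trans hz.1, hz.2⟩) (fun a b ha hab hb => h a b (hs.trans ha) hab hb)
  have hmono : MonotoneOn U (Set.uIcc 0 v) := by
    rw [Set.uIcc_of_le hv]
    intro s hs t ht hst
    have h1 := h s t hs.1 hst ht.2
    have h2 : 0 ≤ g s * min (t - s) C :=
      mul_nonneg (h0 s hs) (le_min (sub_nonneg.2 hst) hC.le)
    linarith
  have iU := hmono.intervalIntegrable (μ := volume)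
  have ig := intervalIntegrable_of_bounded hv hg h0 hB
  have im : IntervalIntegrable (fun z => g z * min (v - z) C) volume 0 v :=
    ig.mul_continuousOn (by fun_prop)
  have it : IntervalIntegrable (fun z => z * g z) volume 0 v := ig.continuousOn_mul (by fun_prop)
  have iW : IntervalIntegrable (fun z => ∫ t in z..v, g t) volume 0 v := by
    have hanti : AntitoneOn (fun z => ∫ t in z..v, g t) (Set.uIcc 0 v) := by
      rw [Set.uIcc_of_le hv]
      intro s hs t ht hst
      have e := intervalIntegral.integral_add_adjacent_intervals
        (ig.mono_set (by rw [Set.uIcc_of_le hv, Set.uIcc_of_le hst]; exact Set.Icc_subset_Icc hs.1 ht.2)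
          : IntervalIntegrable g volume s t)
        (ig.mono_set (by rw [Set.uIcc_of_le hv, Set.uIcc_of_le ht.2]; exact Set.Icc_subset_Icc ht.1 le_rfl))
      have := intervalIntegral.integral_nonneg (μ := volume) hst
        (fun z hz => h0 z ⟨hs.1.trans hz.1, hz.2.trans ht.2⟩)
      simp only
      linarith
    exact hanti.intervalIntegrable
  -- The sum of the two bounds on `U v - U z`, by the direct step from `z` to `v` and by the
  -- accumulated small steps. After Fubini the left side has weight min(v - z, C) + z ≥ min(v, C) on
  -- `g`.
  have e1 : ∫ z in (0 : ℝ)..v, (g z * min (v - z) C + ∫ t in z..v, g t)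
      ≤ ∫ z in (0 : ℝ)..v, (2 * U v - 2 * U z) := by
    refine intervalIntegral.integral_mono_on hv (im.add iW) ((by simp : IntervalIntegrable _ _ _ _).sub (iU.const_mul 2)) ?_
    intro z hz
    have h1 := hsub z hz.1 hz.2
    have h2 := h z v hz.1 hz.2 le_rfl
    linarith
  rw [intervalIntegral.integral_add im iW, integral_integral_eq_integral_mul hv hg h0 hB,
    ← intervalIntegral.integral_add im it,
    intervalIntegral.integral_sub (by simp) (iU.const_mul 2)] at e1
  simp only [intervalIntegral.integral_const, intervalIntegral.integral_const_mul, smul_eq_mul,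
    sub_zero] at e1
  have e2 : ∫ z in (0 : ℝ)..v, min v C * g z
      ≤ ∫ z in (0 : ℝ)..v, (g z * min (v - z) C + z * g z) := by
    refine intervalIntegral.integral_mono_on hv (ig.const_mul _) (im.add it) ?_
    intro z hz
    have : min v C ≤ min (v - z) C + z := by
      rw [← min_add_add_right]
      exact min_le_min (by linarith) (by linarith [hz.1])
    nlinarith [h0 z hz]
  rw [intervalIntegral.integral_const_mul] at e2
  have e3 := hsub 0 le_rfl hv
  -- For `v < C` the weight min(v, C) falls short of C; the missing C - v is paid for by `∫ g ≤ U
  -- v`, which uses `0 ≤ U 0`.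
  have e4 : max (C - v) 0 * ∫ z in (0 : ℝ)..v, g z ≤ max (C - v) 0 * U v :=
    mul_le_mul_of_nonneg_left (by linarith) (le_max_right _ _)
  have e5 : min v C + max (C - v) 0 = C := by
    rcases le_total v C with h | h
    · rw [min_eq_left h, max_eq_left (by linarith)]; ring
    · rw [min_eq_right h, max_eq_right (by linarith)]; ring
  calc C * ∫ z in (0 : ℝ)..v, g z
      = min v C * (∫ z in (0 : ℝ)..v, g z) + max (C - v) 0 * ∫ z in (0 : ℝ)..v, g z := by
        rw [← add_mul, e5]
    _ ≤ _ := by linarith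

end RealAnalysis

/-! ### Virtual values and threshold payments -/

namespace ValueDistribution

variable (F : ValueDistribution)

instance : IsProbabilityMeasure F.law := F.isProb

theorem measurableSet_types : MeasurableSet F.types := F.types_ordConnected.measurableSet

theorem measurable_virtualValue : Measurable F.virtualValue :=
  measurable_id.sub
    ((measurable_const.sub (monotone_cdf F.law).measurable).div F.measurable_density)

theorem types_nonempty : F.types.Nonempty := by
  obtain ⟨v, hv⟩ := F.law_types.exists
  exact ⟨v, hv⟩

theorem law_Ioi (z : ℝ) : F.law (Set.Ioi z) = ENNReal.ofReal (1 - cdf F.law z) := by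
  rw [← Set.compl_Iic, prob_compl_eq_one_sub measurableSet_Iic,
    ENNReal.ofReal_sub _ (cdf_nonneg _ _), ofReal_cdf, ENNReal.ofReal_one]

theorem law_Ioi_eq_zero_of_forall_le {z : ℝ} (hz : ∀ w ∈ F.types, w ≤ z) : F.law (Set.Ioi z) = 0 := by
  refine measure_mono_null (fun w hw => ?_) F.law_types
  exact fun h => absurd (hz w h) (not_le.2 hw)

/-- The types that are not the largest type. -/
def lowerTypes : Set ℝ := {v | v ∈ F.types ∧ ∃ w ∈ F.types, v < w}

theorem measurableSet_lowerTypes : MeasurableSet F.lowerTypes := by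
  refine Set.OrdConnected.measurableSet ⟨fun s hs t ht z hz => ?_⟩
  obtain ⟨w, hw, htw⟩ := ht.2
  exact ⟨F.types_ordConnected.out hs.1 ht.1 hz, w, hw, hz.2.trans_lt htw⟩

/-- Makes the unconstrained density at the largest type harmless: the numerator of the inverse
hazard rate vanishes there, whatever the denominator is, zero included. -/
theorem one_sub_cdf_eq_zero_of_notMem_lowerTypes {v : ℝ} (hv : v ∈ F.types) (h : v ∉ F.lowerTypes) :
    1 - cdf F.law v = 0 := by
  have h1 := F.law_Ioi_eq_zero_of_forall_le (z := v) fun w hw => not_lt.1 fun hlt => h ⟨hv, w, hw, hlt⟩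
  rw [law_Ioi, ENNReal.ofReal_eq_zero] at h1
  exact le_antisymm h1 (sub_nonneg.2 (cdf_le_one _ _))

/-- The inverse hazard rate. -/
def invHazard (v : ℝ) : ℝ := (1 - cdf F.law v) / F.density v

theorem measurable_invHazard : Measurable F.invHazard :=
  (measurable_const.sub (monotone_cdf F.law).measurable).div F.measurable_density

theorem invHazard_nonneg {v : ℝ} (hv : v ∈ F.types) : 0 ≤ F.invHazard v := by
  by_cases h : v ∈ F.lowerTypes
  · exact div_nonneg (sub_nonneg.2 (cdf_le_one _ _)) (F.density_pos v hv h.2).le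
  · rw [invHazard, F.one_sub_cdf_eq_zero_of_notMem_lowerTypes hv h, zero_div]

theorem virtualValue_eq (v : ℝ) : F.virtualValue v = v - F.invHazard v := rfl

/-- The density in the denominator cancels against the density of the law, leaving (1 - F(z)) y(z)
dz, and Tonelli turns this into the expected information rent. An atom at the largest type
contributes nothing. In `ℝ≥0∞` no finiteness is needed. -/
theorem lintegral_invHazard_mul {y : ℝ → ℝ} (hy : Measurable y) (h0 : ∀ v ∈ F.types, 0 ≤ y v) :
    ∫⁻ v, ENNReal.ofReal (F.invHazard v * y v) ∂F.law
      = ∫⁻ v, (∫⁻ z in Set.Iio v, ENNReal.ofReal (F.types.indicator y z)) ∂F.law := by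
  rw [lintegral_setLIntegral_Iio _ _ (hy.indicator F.measurableSet_types).ennreal_ofReal]
  have h1 : ∫⁻ v, ENNReal.ofReal (F.invHazard v * y v) ∂F.law
      = ∫⁻ v in F.lowerTypes, ENNReal.ofReal (F.invHazard v * y v) ∂F.law := by
    rw [← lintegral_indicator F.measurableSet_lowerTypes]
    refine lintegral_congr_ae ?_
    filter_upwards [F.law_types] with v hv
    by_cases h : v ∈ F.lowerTypes
    · rw [Set.indicator_of_mem h]
    · rw [Set.indicator_of_notMem h, invHazard, F.one_sub_cdf_eq_zero_of_notMem_lowerTypes hv h]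
      simp
  rw [h1]
  have h2 : F.law.restrict F.lowerTypes = (volume.restrict F.lowerTypes).withDensity
      (fun v => ENNReal.ofReal (F.density v)) := F.law_eq_density
  rw [h2, lintegral_withDensity_eq_lintegral_mul _ F.measurable_density.ennreal_ofReal
    (show Measurable fun v => ENNReal.ofReal (F.invHazard v * y v) from
      (F.measurable_invHazard.mul hy).ennreal_ofReal),
    ← lintegral_indicator F.measurableSet_lowerTypes]
  refine lintegral_congr fun z => ?_
  by_cases h : z ∈ F.lowerTypes
  · have hf := F.density_pos z h.1 h.2
    rw [Set.indicator_of_mem h, Set.indicator_of_mem h.1, Pi.mul_apply, law_Ioi,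
      ← ENNReal.ofReal_mul hf.le, ← ENNReal.ofReal_mul (h0 z h.1), invHazard]
    congr 1
    field_simp
  · rw [Set.indicator_of_notMem h]
    by_cases hz : z ∈ F.types
    · rw [law_Ioi, F.one_sub_cdf_eq_zero_of_notMem_lowerTypes hz h]
      simp
    · simp [Set.indicator_of_notMem hz]

variable {F} {y : ℝ → ℝ} {B : ℝ}

theorem intervalIntegrable_indicator (hy : Measurable y) (h0 : ∀ v ∈ F.types, 0 ≤ y v)
    (hB : ∀ v ∈ F.types, y v ≤ B) (a b : ℝ) :
    IntervalIntegrable (F.types.indicator y) volume a b := by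
  have hB0 : 0 ≤ B := by
    obtain ⟨v, hv⟩ := F.types_nonempty
    exact (h0 v hv).trans (hB v hv)
  wlog hab : a ≤ b generalizing a b
  · exact (this b a (le_of_not_ge hab)).symm
  refine intervalIntegrable_of_bounded (B := B) hab (hy.indicator F.measurableSet_types)
    (fun z _ => Set.indicator_nonneg h0 z) fun z _ => ?_
  by_cases hz : z ∈ F.types
  · simpa [hz] using hB z hz
  · simpa [hz] using hB0

theorem ofReal_integral_indicator (hy : Measurable y) (h0 : ∀ v ∈ F.types, 0 ≤ y v)
    (hB : ∀ v ∈ F.types, y v ≤ B) {v : ℝ} (hv : 0 ≤ v) :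
    ENNReal.ofReal (∫ z in (0 : ℝ)..v, F.types.indicator y z)
      = ∫⁻ z in Set.Iio v, ENNReal.ofReal (F.types.indicator y z) := by
  have hi := intervalIntegrable_indicator hy h0 hB 0 v
  rw [intervalIntegrable_iff_integrableOn_Ioc_of_le hv] at hi
  rw [intervalIntegral.integral_of_le hv, ofReal_integral_eq_lintegral_ofReal hi
    (ae_of_all _ fun z => Set.indicator_nonneg h0 z), ← lintegral_indicator measurableSet_Ioc,
    ← lintegral_indicator measurableSet_Iio]
  refine lintegral_congr_ae ?_
  -- The interval integral runs over `Set.Ioc 0 v` and the other over `Set.Iio v`; as types are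
  -- nonnegative, the integrands can differ only at the two end points.
  filter_upwards [Measure.ae_ne volume 0, Measure.ae_ne volume v] with z hz0 hzv
  by_cases hz : z ∈ F.types
  · have := lt_of_le_of_ne (F.types_nonneg z hz) (Ne.symm hz0)
    by_cases hzv' : z < v
    · rw [Set.indicator_of_mem (Set.mem_Ioc.2 ⟨this, hzv'.le⟩), Set.indicator_of_mem (Set.mem_Iio.2 hzv')]
    · have h3 : ¬ z ≤ v := fun h => hzv' (lt_of_le_of_ne h hzv)
      rw [Set.indicator_of_notMem (fun h : z ∈ Set.Ioc 0 v => h3 h.2),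
        Set.indicator_of_notMem (fun h : z ∈ Set.Iio v => hzv' h)]
  · simp [Set.indicator, hz]

/-- The expected threshold payment for an interim allocation `y` is the expected virtual surplus. -/
theorem integral_virtualValue_mul (hmean : Integrable (fun v : ℝ => v) F.law) (hy : Measurable y)
    (h0 : ∀ v ∈ F.types, 0 ≤ y v) (hB : ∀ v ∈ F.types, y v ≤ B) :
    Integrable (fun v => F.virtualValue v * y v) F.law ∧
    Integrable (fun v => v * y v - ∫ z in (0 : ℝ)..v, F.types.indicator y z) F.law ∧
    ∫ v, F.virtualValue v * y v ∂F.law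
      = ∫ v, (v * y v - ∫ z in (0 : ℝ)..v, F.types.indicator y z) ∂F.law := by
  have hB0 : 0 ≤ B := by
    obtain ⟨v, hv⟩ := F.types_nonempty
    exact (h0 v hv).trans (hB v hv)
  have hpos : ∀ᵐ v ∂F.law, 0 ≤ ∫ z in (0 : ℝ)..v, F.types.indicator y z := by
    filter_upwards [F.law_types] with v hv
    exact intervalIntegral.integral_nonneg (F.types_nonneg v hv)
      fun z _ => Set.indicator_nonneg h0 z
  have hkpos : ∀ᵐ v ∂F.law, 0 ≤ F.invHazard v * y v := by
    filter_upwards [F.law_types] with v hv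
    exact mul_nonneg (F.invHazard_nonneg hv) (h0 v hv)
  have iv : Integrable (fun v => v * y v) F.law := by
    refine (hmean.mul_const B).mono (measurable_id.mul hy).aestronglyMeasurable ?_
    filter_upwards [F.law_types] with v hv
    rw [norm_mul, norm_mul]
    refine mul_le_mul_of_nonneg_left ?_ (norm_nonneg _)
    rw [Real.norm_of_nonneg (h0 v hv), Real.norm_of_nonneg hB0]
    exact hB v hv
  have hHm : Measurable fun v => ∫ z in (0 : ℝ)..v, F.types.indicator y z :=
    (intervalIntegral.continuous_primitive (intervalIntegrable_indicator hy h0 hB) 0).measurable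
  have iH : Integrable (fun v => ∫ z in (0 : ℝ)..v, F.types.indicator y z) F.law := by
    refine (hmean.mul_const B).mono' hHm.aestronglyMeasurable ?_
    filter_upwards [F.law_types, hpos] with v hv hp
    rw [Real.norm_of_nonneg hp]
    have : ∫ z in (0 : ℝ)..v, F.types.indicator y z ≤ ∫ z in (0 : ℝ)..v, B := by
      refine intervalIntegral.integral_mono_on (F.types_nonneg v hv)
        (intervalIntegrable_indicator hy h0 hB 0 v) (by simp) fun z _ => ?_
      by_cases hz : z ∈ F.types
      · simpa [hz] using hB z hz
      · simpa [hz] using hB0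
    simpa using this
  have hl : ∫⁻ v, ENNReal.ofReal (F.invHazard v * y v) ∂F.law
      = ∫⁻ v, ENNReal.ofReal (∫ z in (0 : ℝ)..v, F.types.indicator y z) ∂F.law := by
    rw [F.lintegral_invHazard_mul hy h0]
    refine lintegral_congr_ae ?_
    filter_upwards [F.law_types] with v hv
    rw [ofReal_integral_indicator hy h0 hB (F.types_nonneg v hv)]
  have hkm : AEStronglyMeasurable (fun v => F.invHazard v * y v) F.law :=
    (F.measurable_invHazard.mul hy).aestronglyMeasurable
  -- The density may be arbitrarily small, so integrability of the hazard term is not evident; it is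
  -- inherited from the rent, which has the same lower integral and is at most `v * B`.
  have ik : Integrable (fun v => F.invHazard v * y v) F.law := by
    rw [← lintegral_ofReal_ne_top_iff_integrable hkm hkpos, hl]
    exact (lintegral_ofReal_ne_top_iff_integrable hHm.aestronglyMeasurable hpos).2 iH
  have e : ∫ v, F.invHazard v * y v ∂F.law
      = ∫ v, (∫ z in (0 : ℝ)..v, F.types.indicator y z) ∂F.law := by
    rw [integral_eq_lintegral_of_nonneg_ae hkpos hkm,
      integral_eq_lintegral_of_nonneg_ae hpos hHm.aestronglyMeasurable, hl]
  have e2 : (fun v => F.virtualValue v * y v) = fun v => v * y v - F.invHazard v * y v := by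
    funext v
    rw [virtualValue_eq, sub_mul]
  rw [e2]
  exact ⟨iv.sub ik, iv.sub iH, by rw [integral_sub iv ik, integral_sub iv iH, e]⟩

end ValueDistribution

/-! ### Expectations with values in `[-∞, ∞]` -/

section ExtendedExpectation

variable {α : Type*} [MeasurableSpace α] {μ : Measure α} {f g : α → ℝ}

/-- Needs neither measurability nor integrability, so that payments can be compared before anything
is known to be finite. -/
theorem eexpect_mono (h : ∀ᵐ x ∂μ, f x ≤ g x) : eexpect μ f ≤ eexpect μ g := by
  refine EReal.sub_le_sub (EReal.coe_ennreal_le_coe_ennreal_iff.2 (lintegral_mono_ae ?_))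
    (EReal.coe_ennreal_le_coe_ennreal_iff.2 (lintegral_mono_ae ?_))
  · filter_upwards [h] with x hx using ENNReal.ofReal_le_ofReal hx
  · filter_upwards [h] with x hx using ENNReal.ofReal_le_ofReal (neg_le_neg hx)

theorem eexpect_eq_integral (hf : Integrable f μ) : eexpect μ f = ((∫ x, f x ∂μ : ℝ) : EReal) := by
  have h1 : ∫⁻ x, ENNReal.ofReal (f x) ∂μ ≠ ⊤ := hf.lintegral_lt_top.ne
  have h2 : ∫⁻ x, ENNReal.ofReal (-f x) ∂μ ≠ ⊤ := hf.neg.lintegral_lt_top.ne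
  rw [integral_eq_lintegral_pos_part_sub_lintegral_neg_part hf, EReal.coe_sub,
    EReal.coe_ennreal_toReal h1, EReal.coe_ennreal_toReal h2, eexpect]

theorem eexpect_eq_top (hf : ∀ᵐ x ∂μ, 0 ≤ f x) (hm : AEStronglyMeasurable f μ)
    (hi : ¬ Integrable f μ) : eexpect μ f = ⊤ := by
  have h1 : ∫⁻ x, ENNReal.ofReal (f x) ∂μ = ⊤ := by
    by_contra h
    exact hi ((lintegral_ofReal_ne_top_iff_integrable hm hf).1 h)
  have h2 : ∫⁻ x, ENNReal.ofReal (-f x) ∂μ = 0 := by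
    rw [← lintegral_zero (μ := μ)]
    refine lintegral_congr_ae ?_
    filter_upwards [hf] with x hx
    simpa using hx
  simp [eexpect, h1, h2]

theorem integrable_of_lintegral_ne_top (hm : AEStronglyMeasurable f μ)
    (h1 : ∫⁻ x, ENNReal.ofReal (f x) ∂μ ≠ ⊤) (h2 : ∫⁻ x, ENNReal.ofReal (-f x) ∂μ ≠ ⊤) :
    Integrable f μ := by
  refine ⟨hm, ?_⟩
  rw [hasFiniteIntegral_iff_norm]
  have : ∀ x, ENNReal.ofReal ‖f x‖ = ENNReal.ofReal (f x) + ENNReal.ofReal (-f x) := by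
    intro x
    rcases le_total 0 (f x) with hx | hx
    · rw [Real.norm_of_nonneg hx, ENNReal.ofReal_of_nonpos (neg_nonpos.2 hx), add_zero]
    · rw [Real.norm_of_nonpos hx, ENNReal.ofReal_of_nonpos hx, zero_add]
  simp_rw [this]
  rw [lintegral_add_left' hm.aemeasurable.ennreal_ofReal]
  exact ENNReal.add_lt_top.2 ⟨h1.lt_top, h2.lt_top⟩

/-- A function bounded above by an integrable function is integrable, or its expectation
is `-∞`. -/
theorem integrable_of_eexpect_ne_bot (hm : AEStronglyMeasurable f μ) (hg : Integrable g μ)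
    (h : ∀ᵐ x ∂μ, f x ≤ g x) (hbot : eexpect μ f ≠ ⊥) : Integrable f μ := by
  refine integrable_of_lintegral_ne_top hm ((lintegral_mono_ae
    (h.mono fun x hx => ENNReal.ofReal_le_ofReal hx)).trans_lt hg.lintegral_lt_top).ne fun h2 => ?_
  apply hbot
  rw [eexpect, h2, EReal.coe_ennreal_top, EReal.sub_top]

/-- A function bounded below by an integrable function is integrable, or its expectation
is `∞`. -/
theorem integrable_of_eexpect_ne_top (hm : AEStronglyMeasurable f μ) (hg : Integrable g μ)
    (h : ∀ᵐ x ∂μ, g x ≤ f x) (htop : eexpect μ f ≠ ⊤) : Integrable f μ := by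
  have h2 : ∫⁻ x, ENNReal.ofReal (-f x) ∂μ ≠ ⊤ := ((lintegral_mono_ae
    (h.mono fun x hx => ENNReal.ofReal_le_ofReal (neg_le_neg hx))).trans_lt
      hg.neg.lintegral_lt_top).ne
  refine integrable_of_lintegral_ne_top hm (fun h1 => ?_) h2
  apply htop
  rw [eexpect, h1, EReal.coe_ennreal_top, ← EReal.coe_ennreal_toReal h2, EReal.top_sub_coe]

end ExtendedExpectation

/-! ### Winners by highest score -/

section TopScore

variable {n : ℕ}

theorem exists_hasTopScore {s : Fin n → ℝ} {i : Fin n} (h : 0 ≤ s i) : ∃ k, HasTopScore s k := by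
  obtain ⟨m, -, hm⟩ := Finset.exists_max_image Finset.univ s ⟨i, Finset.mem_univ i⟩
  have hne : (Finset.univ.filter fun j => s j = s m).Nonempty := ⟨m, by simp⟩
  set k := (Finset.univ.filter fun j => s j = s m).min' hne with hk
  have hkm : s k = s m := by
    have := Finset.min'_mem _ hne
    simpa using this
  refine ⟨k, ?_, fun j => ⟨?_, fun hj => ?_⟩⟩
  · rw [hkm]
    exact h.trans (hm i (Finset.mem_univ i))
  · rw [hkm]
    exact hm j (Finset.mem_univ j)
  · refine lt_of_le_of_ne (by rw [hkm]; exact hm j (Finset.mem_univ j)) fun he => ?_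
    exact absurd (Finset.min'_le _ j (by simp [he, hkm])) (not_le.2 hj)

theorem measurableSet_hasTopScore {α : Type*} [MeasurableSpace α] {s : α → Fin n → ℝ}
    (hs : ∀ j, Measurable fun a => s a j) (i : Fin n) : MeasurableSet {a | HasTopScore (s a) i} := by
  have : {a | HasTopScore (s a) i} = {a | 0 ≤ s a i} ∩
      ⋂ j, ({a | s a j ≤ s a i} ∩ {a | j < i → s a j < s a i}) := by
    ext a
    simp [HasTopScore, forall_and]
  rw [this]
  refine (measurableSet_le measurable_const (hs i)).inter (MeasurableSet.iInter fun j =>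
    (measurableSet_le (hs j) (hs i)).inter ?_)
  by_cases hj : j < i
  · simpa [hj] using measurableSet_lt (hs j) (hs i)
  · simp [hj]

theorem HasTopScore.update_mono {s s' : Fin n → ℝ} {i : Fin n} (h : HasTopScore s i)
    (hi : s i ≤ s' i) (hne : ∀ j, j ≠ i → s' j = s j) : HasTopScore s' i := by
  refine ⟨h.1.trans hi, fun j => ?_⟩
  rcases eq_or_ne j i with rfl | hj
  · exact ⟨le_rfl, fun hlt => absurd hlt (lt_irrefl _)⟩
  · rw [hne j hj]
    exact ⟨(h.2 j).1.trans hi, fun hlt => ((h.2 j).2 hlt).trans_le hi⟩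

theorem le_highestOther {b : Fin n → ℝ} {i j : Fin n} (hj : j ≠ i) : b j ≤ highestOther b i :=
  (Finset.le_fold_max _).2 (Or.inr ⟨j, by simp [hj], le_rfl⟩)

theorem highestOther_nonneg (b : Fin n → ℝ) (i : Fin n) : 0 ≤ highestOther b i :=
  (Finset.le_fold_max _).2 (Or.inl le_rfl)

theorem highestOther_le {b : Fin n → ℝ} {i : Fin n} (h : HasTopScore b i) :
    highestOther b i ≤ b i :=
  (Finset.fold_max_le _).2 ⟨h.1, fun j _ => (h.2 j).1⟩

theorem highestOther_update (b : Fin n → ℝ) (i : Fin n) (z : ℝ) :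
    highestOther (Function.update b i z) i = highestOther b i := by
  refine Finset.fold_congr fun j hj => ?_
  exact Function.update_of_ne (Finset.ne_of_mem_erase hj) _ _

theorem measurable_highestOther (i : Fin n) : Measurable fun b : Fin n → ℝ => highestOther b i := by
  unfold highestOther
  induction (Finset.univ.erase i) using Finset.induction_on with
  | empty => simp
  | insert a s ha ih =>
    simp only [Finset.fold_insert ha]
    exact (measurable_pi_apply a).max ih

theorem le_highestOther_of_not_hasTopScore {b : Fin n → ℝ} {i : Fin n} (h0 : 0 ≤ b i)
    (h : ¬ HasTopScore b i) : b i ≤ highestOther b i := by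
  by_contra! hlt
  refine h ⟨h0, fun j => ?_⟩
  rcases eq_or_ne j i with rfl | hj
  · exact ⟨le_rfl, fun hlt => absurd hlt (lt_irrefl _)⟩
  · have := (le_highestOther (b := b) hj).trans_lt hlt
    exact ⟨this.le, fun _ => this⟩

end TopScore

/-! ### Joint law of seeds and values, dominant strategies -/

namespace Mechanism

variable {n : ℕ} {R : Type*} [MeasurableSpace R] (M : Mechanism n R) (F : Fin n → ValueDistribution)

instance : IsProbabilityMeasure M.seedLaw := M.isProb

/-- The joint law of the values of the bidders. -/
abbrev _root_.valueLaw (F : Fin n → ValueDistribution) : Measure (Fin n → ℝ) :=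
  Measure.pi fun i => (F i).law

theorem jointLaw_eq : M.jointLaw F = M.seedLaw.prod (valueLaw F) := rfl

instance : IsProbabilityMeasure (M.jointLaw F) := by
  rw [jointLaw_eq]
  infer_instance

theorem measurePreserving_snd_jointLaw :
    MeasurePreserving Prod.snd (M.jointLaw F) (valueLaw F) := by
  rw [jointLaw_eq]
  exact measurePreserving_snd

theorem measurePreserving_value (i : Fin n) :
    MeasurePreserving (fun q : R × (Fin n → ℝ) => q.2 i) (M.jointLaw F) (F i).law :=
  (measurePreserving_eval (fun i => (F i).law) i).comp (M.measurePreserving_snd_jointLaw F)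

theorem ae_mem_types : ∀ᵐ q ∂M.jointLaw F, ∀ j, q.2 j ∈ (F j).types := by
  refine ae_all_iff.2 fun j => ?_
  exact (M.measurePreserving_value F j).quasiMeasurePreserving.ae (F j).law_types

variable {M F}

theorem update_mem_types {b : Fin n → ℝ} (hb : ∀ j, b j ∈ (F j).types) {i : Fin n} {z : ℝ}
    (hz : z ∈ (F i).types) (j : Fin n) : Function.update b i z j ∈ (F j).types := by
  rcases eq_or_ne j i with rfl | hj
  · simpa using hz
  · simpa [hj] using hb j

theorem isBIC_of_dominant {u : ℝ → ℝ}
    (h : ∀ (r : R) (b : Fin n → ℝ), (∀ j, b j ∈ (F j).types) → ∀ i, ∀ v ∈ (F i).types,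
      ∀ z ∈ (F i).types,
      u (v * M.alloc r (Function.update b i z) i - M.pay r (Function.update b i z) i) ≤
        u (v * M.alloc r (Function.update b i v) i - M.pay r (Function.update b i v) i)) :
    M.IsBIC F u := by
  intro i v hv z hz
  refine eexpect_mono ?_
  filter_upwards [M.ae_mem_types F] with q hq
  exact h q.1 q.2 hq i v hv z hz

theorem alloc_nonneg (r : R) (b : Fin n → ℝ) (i : Fin n) : 0 ≤ M.alloc r b i := by
  unfold alloc; split_ifs <;> norm_num

theorem alloc_le_one (r : R) (b : Fin n → ℝ) (i : Fin n) : M.alloc r b i ≤ 1 := by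
  unfold alloc; split_ifs <;> norm_num

/-- At most one bidder is served. -/
theorem sum_mul_alloc_le {a : Fin n → ℝ} {c : ℝ} (hc : 0 ≤ c) (r : R) (b : Fin n → ℝ)
    (h : ∀ i, a i ≤ c) : ∑ i, a i * M.alloc r b i ≤ c := by
  rcases hw : M.winner r b with _ | k
  · simpa [alloc, hw] using hc
  · simpa [alloc, hw] using h k

end Mechanism

/-! ### The capacitated second-price auction -/

section CapacitatedSecondPrice

variable {n : ℕ} {C : ℝ} {F : Fin n → ValueDistribution}

open Classical in
theorem capacitatedSecondPrice_alloc (r : Unit) (b : Fin n → ℝ) (i : Fin n) :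
    (capacitatedSecondPrice n C).alloc r b i = if HasTopScore b i then 1 else 0 := by
  simp only [Mechanism.alloc, capacitatedSecondPrice, Mechanism.deterministic,
    topBidder_eq_some_iff]

open Classical in
theorem capacitatedSecondPrice_pay (r : Unit) (b : Fin n → ℝ) (i : Fin n) :
    (capacitatedSecondPrice n C).pay r b i
      = if HasTopScore b i then max (highestOther b i) (b i - C) else 0 := by
  simp only [capacitatedSecondPrice, Mechanism.deterministic, topBidder_eq_some_iff]

theorem capacitatedSecondPrice_isMeasurable : (capacitatedSecondPrice n C).IsMeasurable := by
  intro i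
  simp only [capacitatedSecondPrice_alloc, capacitatedSecondPrice_pay]
  have hs : MeasurableSet {q : Unit × (Fin n → ℝ) | HasTopScore q.2 i} :=
    measurableSet_hasTopScore (fun j => (measurable_pi_apply j).comp measurable_snd) i
  exact ⟨Measurable.ite hs measurable_const measurable_const,
    Measurable.ite hs (((measurable_highestOther i).comp measurable_snd).max
      ((measurable_pi_apply i |>.comp measurable_snd : Measurable fun q : Unit × (Fin n → ℝ) => q.2 i)
        |>.sub_const C)) measurable_const⟩

/-- Let h be the highest other bid. Any winning report costs at least h, hence yields at most min(v
- h, C), and a truthful winner gets exactly this. A truthful loser has v ≤ h, so winning could not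
help her. -/
theorem capacitatedSecondPrice_isAuction (hC : 0 < C) :
    (capacitatedSecondPrice n C).IsAuction F (capUtility C) := by
  refine ⟨capacitatedSecondPrice_isMeasurable, ?_, Mechanism.isBIC_of_dominant ?_⟩
  · intro r b _ i
    rw [capacitatedSecondPrice_pay]
    simp only [capacitatedSecondPrice, Mechanism.deterministic, ne_eq, topBidder_eq_some_iff]
    refine ⟨fun h => ?_, fun h => if_neg h⟩
    rw [if_pos h]
    exact max_le (highestOther_le h) (by linarith)
  · intro r b hb i v hv z hz
    simp only [capacitatedSecondPrice_alloc, capacitatedSecondPrice_pay, highestOther_update,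
      Function.update_self, capUtility]
    have hv0 := (F i).types_nonneg v hv
    have h1 : HasTopScore (Function.update b i v) i → highestOther b i ≤ v := fun h => by
      simpa [highestOther_update] using highestOther_le h
    have h2 : ¬ HasTopScore (Function.update b i v) i → v ≤ highestOther b i := fun h => by
      simpa [highestOther_update] using
        le_highestOther_of_not_hasTopScore (by simpa using hv0) h
    split_ifs with hz' hv' hv'
    all_goals grind

end CapacitatedSecondPrice

/-! ### The risk-neutral optimal auction -/

section Myerson

variable {n : ℕ} {F : Fin n → ValueDistribution}

/-- The types with which bidder `i` wins in the risk-neutral optimal auction. -/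
def winningTypes (F : Fin n → ValueDistribution) (b : Fin n → ℝ) (i : Fin n) : Set ℝ :=
  {z | z ∈ (F i).types ∧ HasTopScore (virtualScores F (Function.update b i z)) i}

open Classical in
theorem myersonAuction_alloc (r : Unit) (b : Fin n → ℝ) (i : Fin n) :
    (myersonAuction F).alloc r b i = if HasTopScore (virtualScores F b) i then 1 else 0 := by
  simp only [Mechanism.alloc, myersonAuction, Mechanism.deterministic, topBidder_eq_some_iff]

open Classical in
theorem myersonAuction_pay (r : Unit) (b : Fin n → ℝ) (i : Fin n) :
    (myersonAuction F).pay r b i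
      = if HasTopScore (virtualScores F b) i then sInf (winningTypes F b i) else 0 := by
  simp only [myersonAuction, Mechanism.deterministic, topBidder_eq_some_iff, winningTypes]

theorem winningTypes_update (b : Fin n → ℝ) (i : Fin n) (v : ℝ) :
    winningTypes F (Function.update b i v) i = winningTypes F b i := by
  simp [winningTypes]

theorem bddBelow_winningTypes (b : Fin n → ℝ) (i : Fin n) : BddBelow (winningTypes F b i) :=
  ⟨0, fun z hz => (F i).types_nonneg z hz.1⟩

theorem sInf_winningTypes_nonneg (b : Fin n → ℝ) (i : Fin n) : 0 ≤ sInf (winningTypes F b i) :=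
  Real.sInf_nonneg fun z hz => (F i).types_nonneg z hz.1

theorem mem_winningTypes_of_le (hF : ∀ i, (F i).IsRegular) {b : Fin n → ℝ} {i : Fin n} {z w : ℝ}
    (hz : z ∈ winningTypes F b i) (hw : w ∈ (F i).types) (hzw : z ≤ w) :
    w ∈ winningTypes F b i := by
  refine ⟨hw, hz.2.update_mono ?_ fun j hj => ?_⟩
  · simpa [virtualScores] using hF i hz.1 hw hzw
  · simp [virtualScores, hj]

theorem measurable_virtualScores (j : Fin n) :
    Measurable fun b : Fin n → ℝ => virtualScores F b j :=
  (F j).measurable_virtualValue.comp (measurable_pi_apply j)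

theorem measurableSet_mem_winningTypes (i : Fin n) {z : ℝ} :
    MeasurableSet {b | z ∈ winningTypes F b i} := by
  by_cases hz : z ∈ (F i).types
  · have : {b | z ∈ winningTypes F b i}
        = {b | HasTopScore (virtualScores F (Function.update b i z)) i} := by
      ext b; simp [winningTypes, hz]
    rw [this]
    refine measurableSet_hasTopScore (fun j => (measurable_virtualScores j).comp ?_) i
    exact measurable_update_left
  · simp [winningTypes, hz]

/-- Countably many types suffice to decide whether there is a winning type below a bound. -/
theorem exists_countable_winningTypes (hF : ∀ i, (F i).IsRegular) (i : Fin n) :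
    ∃ D : Set ℝ, D.Countable ∧ ∀ b c, (∃ z ∈ winningTypes F b i, z < c) ↔
      ∃ z ∈ D, z ∈ winningTypes F b i ∧ z < c := by
  -- Winning types are upward closed, so a winning type that is not the largest has winning
  -- rationals just above it. The largest type has to be added, as it may be irrational and the only
  -- winner.
  refine ⟨Set.range ((↑) : ℚ → ℝ) ∪ {z | IsGreatest (F i).types z},
    (Set.countable_range _).union
      (Set.Subsingleton.countable fun x hx y hy => hx.unique hy), fun b c => ⟨?_, ?_⟩⟩
  · rintro ⟨z, hz, hzc⟩
    by_cases hg : IsGreatest (F i).types z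
    · exact ⟨z, Or.inr hg, hz, hzc⟩
    · obtain ⟨w, hw, hzw⟩ : ∃ w ∈ (F i).types, z < w := by
        by_contra! h
        exact hg ⟨hz.1, h⟩
      obtain ⟨q, hzq, hq⟩ := exists_rat_btwn (lt_min hzw hzc)
      have hqT : (q : ℝ) ∈ (F i).types :=
        (F i).types_ordConnected.out hz.1 hw ⟨hzq.le, (hq.trans_le (min_le_left _ _)).le⟩
      exact ⟨q, Or.inl ⟨q, rfl⟩, mem_winningTypes_of_le hF hz hqT hzq.le,
        hq.trans_le (min_le_right _ _)⟩
  · rintro ⟨z, -, hz, hzc⟩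
    exact ⟨z, hz, hzc⟩

theorem measurable_sInf_winningTypes (hF : ∀ i, (F i).IsRegular) (i : Fin n) :
    Measurable fun b => sInf (winningTypes F b i) := by
  obtain ⟨D, hD, h⟩ := exists_countable_winningTypes hF i
  have hex : ∀ c, MeasurableSet {b | ∃ z ∈ winningTypes F b i, z < c} := by
    intro c
    simp_rw [h]
    have : {b | ∃ z ∈ D, z ∈ winningTypes F b i ∧ z < c}
        = ⋃ z ∈ D, {b | z ∈ winningTypes F b i ∧ z < c} := by
      ext b
      simp only [Set.mem_ofPred_eq, Set.mem_iUnion, exists_prop]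
    rw [this]
    refine MeasurableSet.biUnion hD fun z _ => ?_
    by_cases hz : z < c
    · simpa [hz] using measurableSet_mem_winningTypes i
    · simp [hz]
  have hne : MeasurableSet {b | (winningTypes F b i).Nonempty} := by
    have : {b | (winningTypes F b i).Nonempty}
        = ⋃ m : ℕ, {b | ∃ z ∈ winningTypes F b i, z < m} := by
      ext b
      simp only [Set.mem_ofPred_eq, Set.mem_iUnion]
      constructor
      · rintro ⟨z, hz⟩
        obtain ⟨m, hm⟩ := exists_nat_gt z
        exact ⟨m, z, hz, hm⟩
      · rintro ⟨m, z, hz, -⟩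
        exact ⟨z, hz⟩
    rw [this]
    exact MeasurableSet.iUnion fun m => hex m
  refine measurable_of_Iio fun c => ?_
  -- The second set accounts for the value `0` of `sInf` on the empty set.
  have : (fun b => sInf (winningTypes F b i)) ⁻¹' Set.Iio c
      = {b | ∃ z ∈ winningTypes F b i, z < c}
        ∪ ({b | (winningTypes F b i).Nonempty}ᶜ ∩ {_b | 0 < c}) := by
    ext b
    simp only [Set.mem_preimage, Set.mem_Iio, Set.mem_union, Set.mem_ofPred_eq, Set.mem_inter_iff,
      Set.mem_compl_iff]
    by_cases hb : (winningTypes F b i).Nonempty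
    · simp [hb, csInf_lt_iff (bddBelow_winningTypes b i) hb]
    · rw [Set.not_nonempty_iff_eq_empty.1 hb]
      simp
  rw [this]
  exact (hex c).union (hne.compl.inter (MeasurableSet.const _))

theorem myersonAuction_isMeasurable (hF : ∀ i, (F i).IsRegular) :
    (myersonAuction F).IsMeasurable := by
  intro i
  simp only [myersonAuction_alloc, myersonAuction_pay]
  have hs : MeasurableSet {q : Unit × (Fin n → ℝ) | HasTopScore (virtualScores F q.2) i} :=
    measurableSet_hasTopScore (fun j => (measurable_virtualScores j).comp measurable_snd) i
  exact ⟨Measurable.ite hs measurable_const measurable_const,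
    Measurable.ite hs ((measurable_sInf_winningTypes hF i).comp measurable_snd) measurable_const⟩

/-- The price does not depend on the bidder's own report, and by regularity winning is monotone in
it. Truthtelling thus maximizes wealth ex post, which settles all monotone utilities at once. -/
theorem myersonAuction_isAuction (hF : ∀ i, (F i).IsRegular) {u : ℝ → ℝ} (hu : Monotone u) :
    (myersonAuction F).IsAuction F u := by
  refine ⟨myersonAuction_isMeasurable hF, ?_, Mechanism.isBIC_of_dominant ?_⟩
  · intro r b hb i
    rw [myersonAuction_pay]
    simp only [myersonAuction, Mechanism.deterministic, ne_eq, topBidder_eq_some_iff]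
    refine ⟨fun h => ?_, fun h => if_neg h⟩
    rw [if_pos h]
    exact csInf_le (bddBelow_winningTypes b i) ⟨hb i, by simpa using h⟩
  · intro r b hb i v hv z hz
    refine hu ?_
    simp only [myersonAuction_alloc, myersonAuction_pay, winningTypes_update]
    have h1 : HasTopScore (virtualScores F (Function.update b i v)) i →
        sInf (winningTypes F b i) ≤ v := fun h =>
      csInf_le (bddBelow_winningTypes b i) ⟨hv, h⟩
    have h2 : HasTopScore (virtualScores F (Function.update b i z)) i →
        ¬ HasTopScore (virtualScores F (Function.update b i v)) i →
        v ≤ sInf (winningTypes F b i) := fun hzw hvw =>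
      le_csInf ⟨z, hz, hzw⟩ fun w hw => by
        by_contra! hlt
        exact hvw (mem_winningTypes_of_le hF hw hv hlt.le).2
    split_ifs with hz' hv' hv'
    all_goals grind

/-- The payment identity of the risk-neutral optimal auction. -/
theorem myersonAuction_pay_update (hF : ∀ i, (F i).IsRegular) (r : Unit) (b : Fin n → ℝ)
    (i : Fin n) {v : ℝ} (hv : v ∈ (F i).types) :
    (myersonAuction F).pay r (Function.update b i v) i
      = v * (myersonAuction F).alloc r (Function.update b i v) i
        - ∫ z in (0 : ℝ)..v, (F i).types.indicator
            (fun z => (myersonAuction F).alloc r (Function.update b i z) i) z := by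
  have hv0 := (F i).types_nonneg v hv
  have hind : ∀ z, (F i).types.indicator
      (fun z => (myersonAuction F).alloc r (Function.update b i z) i) z
      = (winningTypes F b i).indicator (fun _ => 1) z := by
    intro z
    by_cases hz : z ∈ (F i).types
    · by_cases hw : HasTopScore (virtualScores F (Function.update b i z)) i
      · simp [myersonAuction_alloc, winningTypes, hz, hw]
      · simp [myersonAuction_alloc, winningTypes, hz, hw]
    · simp [winningTypes, hz]
  simp_rw [hind]
  rw [myersonAuction_alloc, myersonAuction_pay, winningTypes_update]
  by_cases hw : HasTopScore (virtualScores F (Function.update b i v)) i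
  · have hmem : v ∈ winningTypes F b i := ⟨hv, hw⟩
    have ht0 := sInf_winningTypes_nonneg (F := F) b i
    have htv := csInf_le (bddBelow_winningTypes b i) hmem
    set t := sInf (winningTypes F b i) with ht
    -- Whether the threshold `t` itself wins is not known; open intervals avoid the question.
    have e1 : Set.EqOn ((winningTypes F b i).indicator fun _ => (1 : ℝ)) (fun _ => 0)
        (Set.Ioo 0 t) := fun z hz =>
      Set.indicator_of_notMem (fun h => absurd (csInf_le (bddBelow_winningTypes b i) h)
        (not_le.2 hz.2)) _
    have e2 : Set.EqOn ((winningTypes F b i).indicator fun _ => (1 : ℝ)) (fun _ => 1)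
        (Set.Ioo t v) := fun z hz => by
      obtain ⟨w, hw, hwz⟩ := exists_lt_of_csInf_lt ⟨v, hmem⟩ hz.1
      exact Set.indicator_of_mem (mem_winningTypes_of_le hF hw
        ((F i).types_ordConnected.out hw.1 hv ⟨hwz.le, hz.2.le⟩) hwz.le) _
    have i1 : IntervalIntegrable ((winningTypes F b i).indicator fun _ => (1 : ℝ)) volume 0 t :=
      (intervalIntegrable_congr_uIoo (by rwa [Set.uIoo_of_le ht0])).2 (by simp)
    have i2 : IntervalIntegrable ((winningTypes F b i).indicator fun _ => (1 : ℝ)) volume t v :=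
      (intervalIntegrable_congr_uIoo (by rwa [Set.uIoo_of_le htv])).2 (by simp)
    rw [← intervalIntegral.integral_add_adjacent_intervals i1 i2,
      intervalIntegral.integral_congr_Ioo_of_le ht0 e1,
      intervalIntegral.integral_congr_Ioo_of_le htv e2]
    simp [hw]
  · have e : Set.EqOn ((winningTypes F b i).indicator fun _ => (1 : ℝ)) (fun _ => 0)
        (Set.Ioo 0 v) := fun z hz =>
      Set.indicator_of_notMem (fun h => hw (mem_winningTypes_of_le hF h hv hz.2.le).2) _
    rw [intervalIntegral.integral_congr_Ioo_of_le hv0 e]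
    simp [hw]

end Myerson

/-! ### Resampling one value and interim quantities -/

namespace Mechanism

variable {n : ℕ} {R : Type*} [MeasurableSpace R] {M : Mechanism n R} {F : Fin n → ValueDistribution}

/-- The preimage of a box leaves the overwritten coordinate free, which contributes a factor of
total mass 1. -/
theorem measurePreserving_update (F : Fin n → ValueDistribution) (i : Fin n) :
    MeasurePreserving (fun p : ℝ × (Fin n → ℝ) => Function.update p.2 i p.1)
      ((F i).law.prod (valueLaw F)) (valueLaw F) := by
  have hm : Measurable fun p : ℝ × (Fin n → ℝ) => Function.update p.2 i p.1 :=
    measurable_update'.comp measurable_swap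
  refine ⟨hm, (Measure.pi_eq fun s hs => ?_).symm⟩
  rw [Measure.map_apply hm (MeasurableSet.univ_pi hs)]
  have : (fun p : ℝ × (Fin n → ℝ) => Function.update p.2 i p.1) ⁻¹' Set.univ.pi s
      = s i ×ˢ Set.univ.pi (Function.update s i Set.univ) := by
    ext p
    simp only [Set.mem_preimage, Set.mem_univ_pi, Set.mem_prod]
    constructor
    · intro h
      refine ⟨by simpa using h i, fun j => ?_⟩
      rcases eq_or_ne j i with rfl | hj
      · simp
      · simpa [hj] using h j
    · rintro ⟨h1, h2⟩ j
      rcases eq_or_ne j i with rfl | hj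
      · simpa using h1
      · simpa [hj] using h2 j
  rw [this, Measure.prod_prod, Measure.pi_pi, ← Finset.mul_prod_erase _ _ (Finset.mem_univ i),
    ← Finset.mul_prod_erase (a := i) _ (fun j => (F j).law (s j)) (Finset.mem_univ i)]
  simp only [Function.update_self, measure_univ, one_mul]
  congr 1
  exact Finset.prod_congr rfl fun j hj => by rw [Function.update_of_ne (Finset.ne_of_mem_erase hj)]

/-- Seed and reports after bidder `i` has replaced her report. -/
def replaceReport (i : Fin n) (p : ℝ × (R × (Fin n → ℝ))) : R × (Fin n → ℝ) :=
  (p.2.1, Function.update p.2.2 i p.1)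

theorem measurable_replaceReport (i : Fin n) :
    Measurable (replaceReport i : ℝ × (R × (Fin n → ℝ)) → R × (Fin n → ℝ)) :=
  (measurable_fst.comp measurable_snd).prodMk
    (measurable_update'.comp ((measurable_snd.comp measurable_snd).prodMk measurable_fst))

variable (M F)

/-- Resampling the value of one bidder does not change the joint law. -/
theorem measurePreserving_replaceReport (i : Fin n) :
    MeasurePreserving (replaceReport i) ((F i).law.prod (M.jointLaw F)) (M.jointLaw F) := by
  simp only [jointLaw_eq]
  have h1 := (measurePreserving_prodAssoc (F i).law M.seedLaw (valueLaw F)).symm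
  have h2 : MeasurePreserving (Prod.map Prod.swap id)
      (((F i).law.prod M.seedLaw).prod (valueLaw F))
      ((M.seedLaw.prod (F i).law).prod (valueLaw F)) :=
    Measure.measurePreserving_swap.prod (MeasurePreserving.id _)
  have h3 := measurePreserving_prodAssoc M.seedLaw (F i).law (valueLaw F)
  have h4 := (MeasurePreserving.id M.seedLaw).prod (measurePreserving_update F i)
  exact h4.comp (h3.comp (h2.comp h1))

theorem integrable_comp_replaceReport (i : Fin n) {f : R × (Fin n → ℝ) → ℝ}
    (hf : Integrable f (M.jointLaw F)) :
    Integrable (fun p => f (replaceReport i p)) ((F i).law.prod (M.jointLaw F)) :=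
  (M.measurePreserving_replaceReport F i).integrable_comp_of_integrable hf

theorem integral_comp_replaceReport (i : Fin n) {f : R × (Fin n → ℝ) → ℝ}
    (hf : Integrable f (M.jointLaw F)) :
    ∫ p, f (replaceReport i p) ∂((F i).law.prod (M.jointLaw F)) = ∫ q, f q ∂M.jointLaw F := by
  have h := M.measurePreserving_replaceReport F i
  rw [← h.map_eq] at hf
  conv_rhs => rw [← h.map_eq]
  exact (integral_map h.measurable.aemeasurable hf.aestronglyMeasurable).symm

theorem integral_eq_integral_interim (i : Fin n) {f : R × (Fin n → ℝ) → ℝ}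
    (hf : Integrable f (M.jointLaw F)) :
    ∫ q, f q ∂M.jointLaw F
      = ∫ v, (∫ q, f (q.1, Function.update q.2 i v) ∂M.jointLaw F) ∂(F i).law := by
  rw [← M.integral_comp_replaceReport F i hf,
    integral_prod _ (M.integrable_comp_replaceReport F i hf)]
  rfl

/-- The order of integration for ex post identities, which hold for fixed seed and reports of the
others; the opposite order serves interim arguments. -/
theorem integral_eq_integral_resample (i : Fin n) {f : R × (Fin n → ℝ) → ℝ}
    (hf : Integrable f (M.jointLaw F)) :
    ∫ q, f q ∂M.jointLaw F
      = ∫ q, (∫ v, f (q.1, Function.update q.2 i v) ∂(F i).law) ∂M.jointLaw F := by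
  rw [← M.integral_comp_replaceReport F i hf,
    integral_prod_symm _ (M.integrable_comp_replaceReport F i hf)]
  rfl

/-- The interim allocation: the winning probability of bidder `i` with report `z`. -/
def interimAlloc (i : Fin n) (z : ℝ) : ℝ :=
  ∫ q, M.alloc q.1 (Function.update q.2 i z) i ∂M.jointLaw F

variable {M F}

theorem measurable_replaceReport_const (i : Fin n) (z : ℝ) :
    Measurable fun q : R × (Fin n → ℝ) => (q.1, Function.update q.2 i z) :=
  (measurable_replaceReport i).comp (measurable_const.prodMk measurable_id)

theorem IsMeasurable.alloc_update (hM : M.IsMeasurable) (i : Fin n) (z : ℝ) :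
    Measurable fun q : R × (Fin n → ℝ) => M.alloc q.1 (Function.update q.2 i z) i :=
  (hM i).1.comp (measurable_replaceReport_const i z)

theorem IsMeasurable.pay_update (hM : M.IsMeasurable) (i : Fin n) (z : ℝ) :
    Measurable fun q : R × (Fin n → ℝ) => M.pay q.1 (Function.update q.2 i z) i :=
  (hM i).2.comp (measurable_replaceReport_const i z)

theorem norm_alloc_le (r : R) (b : Fin n → ℝ) (i : Fin n) : ‖M.alloc r b i‖ ≤ 1 := by
  rw [Real.norm_of_nonneg (alloc_nonneg r b i)]
  exact alloc_le_one r b i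

theorem IsMeasurable.integrable_alloc_update (hM : M.IsMeasurable) (i : Fin n) (z : ℝ) :
    Integrable (fun q => M.alloc q.1 (Function.update q.2 i z) i) (M.jointLaw F) :=
  Integrable.of_bound (hM.alloc_update i z).aestronglyMeasurable 1
    (ae_of_all _ fun _ => norm_alloc_le _ _ _)

theorem IsMeasurable.measurable_interimAlloc (hM : M.IsMeasurable) (i : Fin n) :
    Measurable (M.interimAlloc F i) :=
  (((hM i).1.comp (measurable_replaceReport i)).stronglyMeasurable.integral_prod_right').measurable

theorem interimAlloc_nonneg (i : Fin n) (z : ℝ) : 0 ≤ M.interimAlloc F i z :=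
  integral_nonneg fun _ => alloc_nonneg _ _ _

theorem IsMeasurable.interimAlloc_le_one (hM : M.IsMeasurable) (i : Fin n) (z : ℝ) :
    M.interimAlloc F i z ≤ 1 := by
  calc M.interimAlloc F i z ≤ ∫ _q, (1 : ℝ) ∂M.jointLaw F :=
        integral_mono (hM.integrable_alloc_update i z) (integrable_const _)
          fun _ => alloc_le_one _ _ _
    _ = 1 := by simp

theorem integrable_value (i : Fin n) {c : ℝ → ℝ} (hc : Integrable c (F i).law) :
    Integrable (fun q : R × (Fin n → ℝ) => c (q.2 i)) (M.jointLaw F) :=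
  (M.measurePreserving_value F i).integrable_comp_of_integrable hc

theorem IsMeasurable.integrable_mul_alloc (hM : M.IsMeasurable) (i : Fin n) {c : ℝ → ℝ}
    (hc : Integrable c (F i).law) :
    Integrable (fun q => c (q.2 i) * M.alloc q.1 q.2 i) (M.jointLaw F) :=
  (integrable_value i hc).mul_bdd (hM i).1.aestronglyMeasurable
    (ae_of_all _ fun _ => norm_alloc_le _ _ _)

theorem IsMeasurable.integral_mul_alloc (hM : M.IsMeasurable) (i : Fin n) {c : ℝ → ℝ}
    (hc : Integrable c (F i).law) :
    ∫ q, c (q.2 i) * M.alloc q.1 q.2 i ∂M.jointLaw F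
      = ∫ v, c v * M.interimAlloc F i v ∂(F i).law := by
  rw [M.integral_eq_integral_interim F i (hM.integrable_mul_alloc i hc)]
  simp only [Function.update_self, integral_const_mul, interimAlloc]

theorem IsMeasurable.integrable_mul_interimAlloc (hM : M.IsMeasurable) (i : Fin n) {c : ℝ → ℝ}
    (hc : Integrable c (F i).law) :
    Integrable (fun v => c v * M.interimAlloc F i v) (F i).law := by
  refine hc.mul_bdd (c := 1) (hM.measurable_interimAlloc i).aestronglyMeasurable (ae_of_all _ fun v => ?_)
  rw [Real.norm_of_nonneg (interimAlloc_nonneg i v)]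
  exact hM.interimAlloc_le_one i v

theorem IsExPostIR.pay_le (h : M.IsExPostIR F) (r : R) {b : Fin n → ℝ}
    (hb : ∀ j, b j ∈ (F j).types) (i : Fin n) : M.pay r b i ≤ b i * M.alloc r b i := by
  by_cases hw : M.winner r b = some i
  · simpa [alloc, hw] using (h r b hb i).1 hw
  · simp [alloc, hw, (h r b hb i).2 hw]

/-- Losers pay nothing, so the total is the payment of the single winner. Integrability of the total
thus passes to each payment. -/
theorem IsExPostIR.abs_pay_le (h : M.IsExPostIR F) (r : R) {b : Fin n → ℝ}
    (hb : ∀ j, b j ∈ (F j).types) (i : Fin n) : |M.pay r b i| ≤ |∑ j, M.pay r b j| := by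
  by_cases hw : M.winner r b = some i
  · rw [Finset.sum_eq_single i]
    · intro j _ hj
      exact (h r b hb j).2 fun h' => hj (Option.some.inj (h'.symm.trans hw))
    · simp
  · rw [(h r b hb i).2 hw, abs_zero]
    exact abs_nonneg _

theorem IsExPostIR.sum_pay_le (h : M.IsExPostIR F) (r : R) {b : Fin n → ℝ}
    (hb : ∀ j, b j ∈ (F j).types) : ∑ i, M.pay r b i ≤ ∑ i, b i :=
  Finset.sum_le_sum fun i _ => (h.pay_le r hb i).trans
    (mul_le_of_le_one_right ((F i).types_nonneg _ (hb i)) (alloc_le_one _ _ _))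

end Mechanism

/-! ### Revenue of the two benchmark auctions -/

section Revenue

variable {n : ℕ} {R : Type*} [MeasurableSpace R] {M : Mechanism n R} {F : Fin n → ValueDistribution}

theorem ValueDistribution.integrable_virtualValue {G : ValueDistribution}
    (h : Integrable (fun v : ℝ => v) G.law) : Integrable G.virtualValue G.law := by
  simpa using (G.integral_virtualValue_mul (y := fun _ => 1) (B := 1) h measurable_const
    (fun _ _ => zero_le_one) fun _ _ => le_rfl).1

/-- The virtual surplus of the risk-neutral optimal auction. -/
def optimalVirtualSurplus (F : Fin n → ValueDistribution) (b : Fin n → ℝ) : ℝ :=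
  ∑ i, (F i).virtualValue (b i) * (myersonAuction F).alloc () b i

theorem optimalVirtualSurplus_eq {b : Fin n → ℝ} {k : Fin n}
    (hk : HasTopScore (virtualScores F b) k) :
    optimalVirtualSurplus F b = (F k).virtualValue (b k) := by
  rw [optimalVirtualSurplus, Finset.sum_eq_single k]
  · simp [myersonAuction_alloc, hk]
  · intro j _ hj
    have : ¬ HasTopScore (virtualScores F b) j := fun h => hj (h.unique hk)
    simp [myersonAuction_alloc, this]
  · simp

theorem optimalVirtualSurplus_nonneg (b : Fin n → ℝ) : 0 ≤ optimalVirtualSurplus F b := by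
  by_cases h : ∃ k, HasTopScore (virtualScores F b) k
  · obtain ⟨k, hk⟩ := h
    rw [optimalVirtualSurplus_eq hk]
    exact hk.1
  · push Not at h
    simp [optimalVirtualSurplus, myersonAuction_alloc, h]

theorem virtualValue_le_optimalVirtualSurplus (b : Fin n → ℝ) (i : Fin n) :
    (F i).virtualValue (b i) ≤ optimalVirtualSurplus F b := by
  by_cases h : 0 ≤ (F i).virtualValue (b i)
  · obtain ⟨k, hk⟩ := exists_hasTopScore (s := virtualScores F b) h
    rw [optimalVirtualSurplus_eq hk]
    exact (hk.2 i).1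
  · exact (not_le.1 h).le.trans (optimalVirtualSurplus_nonneg b)

theorem integrable_optimalVirtualSurplus (hF : ∀ i, (F i).IsRegular)
    (hmean : ∀ i, Integrable (fun v : ℝ => v) (F i).law) :
    Integrable (fun q => optimalVirtualSurplus F q.2) (M.jointLaw F) := by
  have hm : AEStronglyMeasurable (optimalVirtualSurplus F) (valueLaw F) := by
    refine (Finset.measurable_fun_sum _ fun i _ => ?_).aestronglyMeasurable
    exact ((F i).measurable_virtualValue.comp (measurable_pi_apply i)).mul
      ((myersonAuction_isMeasurable hF i).1.comp (measurable_const.prodMk measurable_id))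
  refine (integrable_finsetSum Finset.univ fun i _ => (Mechanism.integrable_value (M := M) i
    ((F i).integrable_virtualValue (hmean i)).abs)).mono'
    (hm.comp_measurePreserving (M.measurePreserving_snd_jointLaw F)) (ae_of_all _ fun q => ?_)
  refine (Finset.abs_sum_le_sum_abs _ _).trans (Finset.sum_le_sum fun i _ => ?_)
  rw [abs_mul]
  exact mul_le_of_le_one_right (abs_nonneg _) (Mechanism.norm_alloc_le () q.2 i)

theorem integral_snd_jointLaw {f : (Fin n → ℝ) → ℝ} (hf : Measurable f) :
    ∫ q, f q.2 ∂M.jointLaw F = ∫ b, f b ∂valueLaw F := by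
  rw [← (M.measurePreserving_snd_jointLaw F).map_eq]
  exact (integral_map measurable_snd.aemeasurable hf.aestronglyMeasurable).symm

theorem measurable_optimalVirtualSurplus (hF : ∀ i, (F i).IsRegular) :
    Measurable (optimalVirtualSurplus F) :=
  Finset.measurable_fun_sum _ fun i _ =>
    ((F i).measurable_virtualValue.comp (measurable_pi_apply i)).mul
      ((myersonAuction_isMeasurable hF i).1.comp (measurable_const.prodMk measurable_id))

/-- The revenue of the risk-neutral optimal auction is its expected virtual surplus. -/
theorem myersonAuction_revenue (hF : ∀ i, (F i).IsRegular)
    (hmean : ∀ i, Integrable (fun v : ℝ => v) (F i).law) :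
    (myersonAuction F).revenue F
      = ((∫ b, optimalVirtualSurplus F b ∂valueLaw F : ℝ) : EReal) := by
  have hM := myersonAuction_isAuction hF (u := id) monotone_id
  have hpay : ∀ i, Integrable (fun q => (myersonAuction F).pay q.1 q.2 i)
      ((myersonAuction F).jointLaw F) := fun i => by
    refine (Mechanism.integrable_value i (hmean i)).mono' (hM.measurable i).2.aestronglyMeasurable ?_
    filter_upwards [(myersonAuction F).ae_mem_types F] with q hq
    have h0 : 0 ≤ (myersonAuction F).pay q.1 q.2 i := by
      rw [myersonAuction_pay]
      split_ifs
      exacts [sInf_winningTypes_nonneg _ _, le_rfl]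
    rw [Real.norm_of_nonneg h0]
    exact (hM.exPostIR.pay_le q.1 hq i).trans
      (mul_le_of_le_one_right ((F i).types_nonneg _ (hq i)) (Mechanism.alloc_le_one _ _ _))
  have hvs : ∀ i, Integrable (fun q => (F i).virtualValue (q.2 i)
      * (myersonAuction F).alloc q.1 q.2 i) ((myersonAuction F).jointLaw F) := fun i =>
    hM.measurable.integrable_mul_alloc i ((F i).integrable_virtualValue (hmean i))
  have he : ∀ i, ∫ q, (myersonAuction F).pay q.1 q.2 i ∂(myersonAuction F).jointLaw F
      = ∫ q, (F i).virtualValue (q.2 i) * (myersonAuction F).alloc q.1 q.2 i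
          ∂(myersonAuction F).jointLaw F := fun i => by
    rw [Mechanism.integral_eq_integral_resample _ F i (hpay i),
      Mechanism.integral_eq_integral_resample _ F i (hvs i)]
    refine integral_congr_ae (ae_of_all _ fun q => ?_)
    have hy : Measurable fun v => (myersonAuction F).alloc q.1 (Function.update q.2 i v) i :=
      (hM.measurable i).1.comp (measurable_const.prodMk (measurable_update q.2))
    simp only [Function.update_self]
    rw [((F i).integral_virtualValue_mul (B := 1) (hmean i) hy
      (fun v _ => Mechanism.alloc_nonneg _ _ _) fun v _ => Mechanism.alloc_le_one _ _ _).2.2]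
    refine integral_congr_ae ?_
    filter_upwards [(F i).law_types] with v hv
    exact myersonAuction_pay_update hF q.1 q.2 i hv
  rw [Mechanism.revenue, eexpect_eq_integral (integrable_finsetSum _ fun i _ => hpay i),
    integral_finsetSum _ fun i _ => hpay i, Finset.sum_congr rfl fun i _ => he i,
    ← integral_finsetSum _ fun i _ => hvs i,
    ← integral_snd_jointLaw (M := myersonAuction F) (measurable_optimalVirtualSurplus hF)]
  rfl

/-- The virtual surplus of any mechanism is at most that of the risk-neutral optimal auction. -/
theorem sum_integral_virtualValue_le (hF : ∀ i, (F i).IsRegular)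
    (hmean : ∀ i, Integrable (fun v : ℝ => v) (F i).law) (hM : M.IsMeasurable) :
    ∑ i, ∫ v, max ((F i).virtualValue v) 0 * M.interimAlloc F i v ∂(F i).law
      ≤ ∫ b, optimalVirtualSurplus F b ∂valueLaw F := by
  have hi : ∀ i, Integrable (fun v => max ((F i).virtualValue v) 0) (F i).law := fun i =>
    ((F i).integrable_virtualValue (hmean i)).pos_part
  rw [Finset.sum_congr rfl fun i _ => (hM.integral_mul_alloc i (hi i)).symm,
    ← integral_finsetSum _ fun i _ => hM.integrable_mul_alloc i (hi i),
    ← integral_snd_jointLaw (M := M) (measurable_optimalVirtualSurplus hF)]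
  refine integral_mono (integrable_finsetSum _ fun i _ => hM.integrable_mul_alloc i (hi i))
    (integrable_optimalVirtualSurplus hF hmean) fun q => ?_
  exact Mechanism.sum_mul_alloc_le (a := fun i => max ((F i).virtualValue (q.2 i)) 0)
    (optimalVirtualSurplus_nonneg _) _ _
    fun i => max_le (virtualValue_le_optimalVirtualSurplus _ _) (optimalVirtualSurplus_nonneg _)

variable {C : ℝ}

/-- If i wins, she pays at least her bid less C; if not, the winner pays at least the bid of i. -/
theorem le_sum_capacitatedSecondPrice_pay (hC : 0 < C) {b : Fin n → ℝ} (hb : ∀ j, 0 ≤ b j)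
    (i : Fin n) : max (b i - C) 0 ≤ ∑ j, (capacitatedSecondPrice n C).pay () b j := by
  obtain ⟨k, hk⟩ := exists_hasTopScore (hb i)
  rw [Finset.sum_eq_single k]
  · rw [capacitatedSecondPrice_pay, if_pos hk]
    refine max_le ?_ (le_max_of_le_left (highestOther_nonneg _ _))
    rcases eq_or_ne i k with rfl | h
    · exact le_max_right _ _
    · exact le_max_of_le_left ((sub_le_self _ hC.le).trans (le_highestOther h))
  · intro j _ hj
    rw [capacitatedSecondPrice_pay, if_neg fun h => hj (h.unique hk)]
  · simp

theorem sum_capacitatedSecondPrice_pay_nonneg (b : Fin n → ℝ) :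
    0 ≤ ∑ j, (capacitatedSecondPrice n C).pay () b j := by
  refine Finset.sum_nonneg fun j _ => ?_
  rw [capacitatedSecondPrice_pay]
  split_ifs
  exacts [le_max_of_le_left (highestOther_nonneg _ _), le_rfl]

theorem measurable_sum_capacitatedSecondPrice_pay :
    Measurable fun b : Fin n → ℝ => ∑ j, (capacitatedSecondPrice n C).pay () b j :=
  Finset.measurable_fun_sum _ fun j _ =>
    (capacitatedSecondPrice_isMeasurable j).2.comp (measurable_const.prodMk measurable_id)

theorem integrable_of_capacitatedSecondPrice_revenue_ne_top
    (h : (capacitatedSecondPrice n C).revenue F ≠ ⊤) :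
    Integrable (fun b => ∑ j, (capacitatedSecondPrice n C).pay () b j) (valueLaw F) := by
  have hp := (capacitatedSecondPrice n C).measurePreserving_snd_jointLaw F
  rw [← hp.integrable_comp measurable_sum_capacitatedSecondPrice_pay.aestronglyMeasurable]
  by_contra hi
  refine h (eexpect_eq_top (ae_of_all _ fun q => sum_capacitatedSecondPrice_pay_nonneg q.2)
    ?_ hi)
  exact (measurable_sum_capacitatedSecondPrice_pay.comp measurable_snd).aestronglyMeasurable

theorem capacitatedSecondPrice_revenue
    (h : Integrable (fun b => ∑ j, (capacitatedSecondPrice n C).pay () b j) (valueLaw F)) :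
    (capacitatedSecondPrice n C).revenue F
      = ((∫ b, ∑ j, (capacitatedSecondPrice n C).pay () b j ∂valueLaw F : ℝ) : EReal) := by
  rw [← integral_snd_jointLaw (M := capacitatedSecondPrice n C)
    measurable_sum_capacitatedSecondPrice_pay]
  exact eexpect_eq_integral
    (((capacitatedSecondPrice n C).measurePreserving_snd_jointLaw F).integrable_comp_of_integrable h)

theorem ae_valueLaw_mem_types : ∀ᵐ b ∂valueLaw F, ∀ j, b j ∈ (F j).types :=
  ae_all_iff.2 fun j =>
    (measurePreserving_eval (fun i => (F i).law) j).quasiMeasurePreserving.ae (F j).law_types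

/-- The values have finite means if the capacitated second-price auction has finite revenue. -/
theorem integrable_id_of_integrable_pay (hC : 0 < C)
    (h : Integrable (fun b => ∑ j, (capacitatedSecondPrice n C).pay () b j) (valueLaw F))
    (i : Fin n) : Integrable (fun v : ℝ => v) (F i).law := by
  refine ((measurePreserving_eval (fun i => (F i).law) i).integrable_comp
    (g := fun v => v) measurable_id.aestronglyMeasurable).1 ?_
  refine (h.add (integrable_const C)).mono' (measurable_pi_apply i).aestronglyMeasurable ?_
  filter_upwards [ae_valueLaw_mem_types (F := F)] with b hb
  have h0 := fun j => (F j).types_nonneg _ (hb j)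
  have h1 := (le_max_left _ _).trans (le_sum_capacitatedSecondPrice_pay hC h0 i)
  change ‖b i‖ ≤ ∑ j, (capacitatedSecondPrice n C).pay () b j + C
  rw [Real.norm_of_nonneg (h0 i)]
  linarith

/-- The surplus above the capacity is at most the revenue of the capacitated second-price
auction. -/
theorem sum_integral_sub_capacity_le (hC : 0 < C)
    (h : Integrable (fun b => ∑ j, (capacitatedSecondPrice n C).pay () b j) (valueLaw F))
    (hM : M.IsMeasurable) :
    ∑ i, ∫ v, max (v - C) 0 * M.interimAlloc F i v ∂(F i).law
      ≤ ∫ b, ∑ j, (capacitatedSecondPrice n C).pay () b j ∂valueLaw F := by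
  have hi : ∀ i, Integrable (fun v => max (v - C) 0) (F i).law := fun i =>
    ((integrable_id_of_integrable_pay hC h i).sub (integrable_const C)).pos_part
  rw [Finset.sum_congr rfl fun i _ => (hM.integral_mul_alloc i (hi i)).symm,
    ← integral_finsetSum _ fun i _ => hM.integrable_mul_alloc i (hi i),
    ← integral_snd_jointLaw (M := M) measurable_sum_capacitatedSecondPrice_pay]
  refine integral_mono_ae (integrable_finsetSum _ fun i _ => hM.integrable_mul_alloc i (hi i))
    ((M.measurePreserving_snd_jointLaw F).integrable_comp_of_integrable h) ?_
  filter_upwards [M.ae_mem_types F] with q hq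
  exact Mechanism.sum_mul_alloc_le (a := fun i => max (q.2 i - C) 0)
    (sum_capacitatedSecondPrice_pay_nonneg _) _ _
    fun i => le_sum_capacitatedSecondPrice_pay hC (fun j => (F j).types_nonneg _ (hq j)) i

end Revenue

/-! ### The approximation bound for capacitated bidders -/

section Capacitated

variable {n : ℕ} {R : Type*} [MeasurableSpace R] {M : Mechanism n R} {F : Fin n → ValueDistribution}
  {C : ℝ}

namespace Mechanism

/-- The utility of bidder `i` with value `v` and report `z`, up to the capacity. -/
def cappedUtility (M : Mechanism n R) (C : ℝ) (i : Fin n) (v z : ℝ) (q : R × (Fin n → ℝ)) : ℝ :=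
  capUtility C (v * M.alloc q.1 (Function.update q.2 i z) i
    - M.pay q.1 (Function.update q.2 i z) i)

/-- The interim utility of a truthful capacitated bidder. -/
def truthfulUtility (M : Mechanism n R) (F : Fin n → ValueDistribution) (C : ℝ) (i : Fin n)
    (v : ℝ) : ℝ :=
  ∫ q, M.cappedUtility C i v v q ∂M.jointLaw F

/-- The third bound is the chord of the concave map w ↦ min(w + v - z, C) between w = 0 and w = C;
beyond C both sides equal C, and for losers all terms vanish. Its linearity in allocation and capped
utility lets it pass to expectations. -/
theorem cappedUtility_bounds (hM : M.IsExPostIR F) (hC : 0 < C) {q : R × (Fin n → ℝ)}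
    (hq : ∀ j, q.2 j ∈ (F j).types) {i : Fin n} {v z : ℝ} (hz : z ∈ (F i).types) (hzv : z ≤ v) :
    0 ≤ M.cappedUtility C i v z q ∧
    M.cappedUtility C i v z q ≤ C * M.alloc q.1 (Function.update q.2 i z) i ∧
    M.cappedUtility C i z z q + (M.alloc q.1 (Function.update q.2 i z) i
      - M.cappedUtility C i z z q / C) * min (v - z) C ≤ M.cappedUtility C i v z q := by
  have hIR := hM q.1 _ (update_mem_types hq hz) i
  simp only [Function.update_self] at hIR
  by_cases hw : M.winner q.1 (Function.update q.2 i z) = some i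
  · have hp := hIR.1 hw
    simp only [cappedUtility, capUtility, alloc, hw, if_true, mul_one]
    set p := M.pay q.1 (Function.update q.2 i z) i
    refine ⟨le_min (by linarith) hC.le, min_le_right _ _, ?_⟩
    rcases le_total C (z - p) with h | h
    · rw [min_eq_right h, min_eq_right (show C ≤ v - p by linarith), div_self hC.ne']
      simp
    · rw [min_eq_left h]
      have h1 : (z - p) / C ≤ 1 := (div_le_one hC).2 h
      have h2 : 0 ≤ (z - p) / C := div_nonneg (by linarith) hC.le
      refine le_min ?_ ?_
      · have : (1 - (z - p) / C) * min (v - z) C ≤ 1 * (v - z) :=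
          mul_le_mul (by linarith) (min_le_left _ _) (le_min (by linarith) hC.le) zero_le_one
        linarith
      · have : (1 - (z - p) / C) * min (v - z) C ≤ (1 - (z - p) / C) * C :=
          mul_le_mul_of_nonneg_left (min_le_right _ _) (by linarith)
        rw [sub_mul 1 ((z - p) / C) C, div_mul_cancel₀ _ hC.ne'] at this
        linarith
  · simp [cappedUtility, capUtility, alloc, hw, hIR.2 hw, hC.le]

theorem IsMeasurable.measurable_cappedUtility (hM : M.IsMeasurable) (i : Fin n) (v z : ℝ) :
    Measurable (M.cappedUtility C i v z) :=
  (((hM.alloc_update i z).const_mul v).sub (hM.pay_update i z)).min measurable_const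

theorem IsAuction.integrable_cappedUtility (hM : M.IsAuction F (capUtility C)) (hC : 0 < C)
    {i : Fin n} {v z : ℝ} (hz : z ∈ (F i).types) (hzv : z ≤ v) :
    Integrable (M.cappedUtility C i v z) (M.jointLaw F) := by
  refine Integrable.of_bound (hM.measurable.measurable_cappedUtility i v z).aestronglyMeasurable C ?_
  filter_upwards [M.ae_mem_types F] with q hq
  have h := cappedUtility_bounds hM.exPostIR hC hq hz hzv
  rw [Real.norm_of_nonneg h.1]
  exact h.2.1.trans (mul_le_of_le_one_right hC.le (alloc_le_one _ _ _))

theorem IsMeasurable.measurable_truthfulUtility (hM : M.IsMeasurable) (i : Fin n) :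
    Measurable (M.truthfulUtility F C i) := by
  have h : Measurable fun p : ℝ × (R × (Fin n → ℝ)) => M.cappedUtility C i p.1 p.1 p.2 :=
    ((measurable_fst.mul ((hM i).1.comp (measurable_replaceReport i))).sub
      ((hM i).2.comp (measurable_replaceReport i))).min measurable_const
  exact h.stronglyMeasurable.integral_prod_right'.measurable

theorem IsAuction.truthfulUtility_nonneg (hM : M.IsAuction F (capUtility C)) (hC : 0 < C)
    {i : Fin n} {v : ℝ} (hv : v ∈ (F i).types) : 0 ≤ M.truthfulUtility F C i v := by
  refine integral_nonneg_of_ae ?_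
  filter_upwards [M.ae_mem_types F] with q hq
  exact (cappedUtility_bounds hM.exPostIR hC hq hv le_rfl).1

/-- Only winners have positive utility, and at most C. This gives both the sign of the slope x - U/C
and the bound x + U/C ≤ 2x. -/
theorem IsAuction.truthfulUtility_le (hM : M.IsAuction F (capUtility C)) (hC : 0 < C)
    {i : Fin n} {v : ℝ} (hv : v ∈ (F i).types) :
    M.truthfulUtility F C i v / C ≤ M.interimAlloc F i v := by
  rw [div_le_iff₀' hC, truthfulUtility, interimAlloc, ← integral_const_mul]
  refine integral_mono_ae (hM.integrable_cappedUtility hC hv le_rfl)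
    ((hM.measurable.integrable_alloc_update i v).const_mul C) ?_
  filter_upwards [M.ae_mem_types F] with q hq
  exact (cappedUtility_bounds hM.exPostIR hC hq hv le_rfl).2.1

/-- Incentive compatibility of a capacitated bidder who considers to shade her report. -/
theorem IsAuction.truthfulUtility_add_le (hM : M.IsAuction F (capUtility C)) (hC : 0 < C)
    {i : Fin n} {v z : ℝ} (hv : v ∈ (F i).types) (hz : z ∈ (F i).types) (hzv : z ≤ v) :
    M.truthfulUtility F C i z
      + (M.interimAlloc F i z - M.truthfulUtility F C i z / C) * min (v - z) C
      ≤ M.truthfulUtility F C i v := by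
  have iz := hM.integrable_cappedUtility hC hz le_rfl
  have ivz := hM.integrable_cappedUtility hC hz hzv
  have ia := hM.measurable.integrable_alloc_update (F := F) i z
  have h1 : ∫ q, M.cappedUtility C i v z q ∂M.jointLaw F ≤ M.truthfulUtility F C i v := by
    have h := hM.bic i v hv z hz
    simp only [interimUtility] at h
    have e1 := eexpect_eq_integral ivz
    have e2 := eexpect_eq_integral (hM.integrable_cappedUtility hC hv le_rfl)
    rw [← EReal.coe_le_coe_iff, truthfulUtility, ← e1, ← e2]
    exact h
  refine le_trans ?_ h1
  have ig : Integrable (fun q => (M.alloc q.1 (Function.update q.2 i z) i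
      - M.cappedUtility C i z z q / C) * min (v - z) C) (M.jointLaw F) :=
    (ia.sub (iz.div_const C)).mul_const _
  rw [truthfulUtility, interimAlloc, ← integral_div, ← integral_sub ia (iz.div_const C),
    ← integral_mul_const, ← integral_add iz ig]
  refine integral_mono_ae (iz.add ig) ivz ?_
  filter_upwards [M.ae_mem_types F] with q hq
  exact (cappedUtility_bounds hM.exPostIR hC hq hz hzv).2.2

/-- The revenue from a capacitated bidder, type by type. -/
theorem IsAuction.mul_interimAlloc_sub_truthfulUtility_le (hM : M.IsAuction F (capUtility C))
    (hC : 0 < C) {i : Fin n} {v : ℝ} (hv : v ∈ (F i).types) :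
    v * M.interimAlloc F i v - M.truthfulUtility F C i v
      ≤ (v * (M.interimAlloc F i v + M.truthfulUtility F C i v / C)
          - ∫ z in (0 : ℝ)..v, (F i).types.indicator
            (fun z => M.interimAlloc F i z + M.truthfulUtility F C i z / C) z)
        + max (v - C) 0 * M.interimAlloc F i v := by
  set x := M.interimAlloc F i with hx
  set U := M.truthfulUtility F C i with hU
  have hxm : Measurable x := hM.measurable.measurable_interimAlloc i
  have hUm : Measurable U := hM.measurable.measurable_truthfulUtility i
  have hgm : Measurable fun z => x z - U z / C := hxm.sub (hUm.div_const C)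
  have hU0 : ∀ z ∈ (F i).types, 0 ≤ U z := fun z hz => hM.truthfulUtility_nonneg hC hz
  have hUx : ∀ z ∈ (F i).types, U z / C ≤ x z := fun z hz => hM.truthfulUtility_le hC hz
  have hx1 : ∀ z, x z ≤ 1 := fun z => hM.measurable.interimAlloc_le_one i z
  have hg0 : ∀ z ∈ (F i).types, 0 ≤ x z - U z / C := fun z hz => sub_nonneg.2 (hUx z hz)
  have hg1 : ∀ z ∈ (F i).types, x z - U z / C ≤ 1 := fun z hz => by
    linarith [hx1 z, div_nonneg (hU0 z hz) hC.le]
  have hUC : ∀ z ∈ (F i).types, U z ≤ C := fun z hz =>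
    (div_le_one hC).1 ((hUx z hz).trans (hx1 z))
  have hv0 := (F i).types_nonneg v hv
  -- Both functions are extended by zero outside the types. Below the types the growth condition
  -- then only asks for nonnegative utility; above a type and up to `v` all points are types.
  have key := mul_integral_le_of_add_mul_min_le (U := (F i).types.indicator U)
    (g := (F i).types.indicator fun z => x z - U z / C) (B := 1) hv0 hC
    (hgm.indicator (F i).measurableSet_types) (fun z _ => Set.indicator_nonneg hg0 z)
    (fun z _ => Set.indicator_le' (fun z hz => hg1 z hz) (fun _ _ => zero_le_one) z)
    (Set.indicator_nonneg hU0 0) (fun s t _ hst htv => by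
      by_cases hs : s ∈ (F i).types
      · have ht : t ∈ (F i).types := (F i).types_ordConnected.out hs hv ⟨hst, htv⟩
        rw [Set.indicator_of_mem hs, Set.indicator_of_mem hs, Set.indicator_of_mem ht]
        exact hM.truthfulUtility_add_le hC ht hs hst
      · rw [Set.indicator_of_notMem hs, Set.indicator_of_notMem hs, zero_mul, add_zero]
        exact Set.indicator_nonneg hU0 t)
  rw [Set.indicator_of_mem hv] at key
  have ig := ValueDistribution.intervalIntegrable_indicator hgm hg0 hg1 0 v
  have iU := ValueDistribution.intervalIntegrable_indicator hUm hU0 hUC 0 v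
  -- The threshold allocation is x + U/C = (x - U/C) + 2U/C, matching the coefficient 2 of `∫ U` in
  -- `key`.
  have hsplit : ∫ z in (0 : ℝ)..v, (F i).types.indicator (fun z => x z + U z / C) z
      = (∫ z in (0 : ℝ)..v, (F i).types.indicator (fun z => x z - U z / C) z)
        + 2 / C * ∫ z in (0 : ℝ)..v, (F i).types.indicator U z := by
    rw [← intervalIntegral.integral_const_mul, ← intervalIntegral.integral_add ig (iU.const_mul _)]
    refine intervalIntegral.integral_congr fun z _ => ?_
    by_cases hz : z ∈ (F i).types
    · simp only [Set.indicator_of_mem hz]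
      ring
    · simp [Set.indicator_of_notMem hz]
  rw [hsplit]
  set W := ∫ z in (0 : ℝ)..v, (F i).types.indicator (fun z => x z - U z / C) z
  set I := ∫ z in (0 : ℝ)..v, (F i).types.indicator U z
  have h1 : max (v - C) 0 * (U v / C) ≤ max (v - C) 0 * x v :=
    mul_le_mul_of_nonneg_left (hUx v hv) (le_max_right _ _)
  have h2 : max (C - v) 0 + v = C + max (v - C) 0 := by
    rcases le_total v C with h | h
    · rw [max_eq_left (by linarith), max_eq_right (by linarith)]; ring
    · rw [max_eq_right (by linarith), max_eq_left (by linarith)]; ring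
  have h3 : W + 2 / C * I ≤ U v + max (v - C) 0 * (U v / C) + v * (U v / C) := by
    have h4 : C * W + 2 * I ≤ C * U v + max (v - C) 0 * U v + v * U v := by
      have : C * U v + max (v - C) 0 * U v + v * U v = (max (C - v) 0 + v) * U v + v * U v := by
        rw [h2]; ring
      rw [this]
      linarith
    have e1 : W + 2 / C * I = (C * W + 2 * I) / C := by field_simp
    have e2 : U v + max (v - C) 0 * (U v / C) + v * (U v / C)
        = (C * U v + max (v - C) 0 * U v + v * U v) / C := by field_simp
    rw [e1, e2]
    exact div_le_div_of_nonneg_right h4 hC.le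
  linarith

/-- The virtual surplus bound on the revenue from one capacitated bidder. -/
theorem IsAuction.integral_surplus_sub_utility_le (hM : M.IsAuction F (capUtility C)) (hC : 0 < C)
    (i : Fin n) (hmean : Integrable (fun v : ℝ => v) (F i).law) :
    Integrable (fun q => q.2 i * M.alloc q.1 q.2 i
      - M.cappedUtility C i (q.2 i) (q.2 i) q) (M.jointLaw F) ∧
    ∫ q, (q.2 i * M.alloc q.1 q.2 i - M.cappedUtility C i (q.2 i) (q.2 i) q) ∂M.jointLaw F
      ≤ 2 * (∫ v, max ((F i).virtualValue v) 0 * M.interimAlloc F i v ∂(F i).law)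
        + ∫ v, max (v - C) 0 * M.interimAlloc F i v ∂(F i).law := by
  have iva := hM.measurable.integrable_mul_alloc (F := F) i hmean
  have hcm : Measurable fun q : R × (Fin n → ℝ) => M.cappedUtility C i (q.2 i) (q.2 i) q := by
    have hvi : Measurable fun q : R × (Fin n → ℝ) => q.2 i :=
      (measurable_pi_apply i).comp measurable_snd
    simp only [cappedUtility, Function.update_eq_self]
    exact ((hvi.mul (hM.measurable i).1).sub (hM.measurable i).2).min measurable_const
  have icu : Integrable (fun q : R × (Fin n → ℝ) => M.cappedUtility C i (q.2 i) (q.2 i) q)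
      (M.jointLaw F) := by
    refine Integrable.of_bound hcm.aestronglyMeasurable C ?_
    filter_upwards [M.ae_mem_types F] with q hq
    have h := cappedUtility_bounds hM.exPostIR hC hq (hq i) le_rfl
    rw [Real.norm_of_nonneg h.1]
    exact h.2.1.trans (mul_le_of_le_one_right hC.le (alloc_le_one _ _ _))
  have isub : Integrable (fun q => q.2 i * M.alloc q.1 q.2 i
      - M.cappedUtility C i (q.2 i) (q.2 i) q) (M.jointLaw F) := iva.sub icu
  refine ⟨isub, ?_⟩
  set x := M.interimAlloc F i with hx
  set U := M.truthfulUtility F C i with hU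
  have hxm : Measurable x := hM.measurable.measurable_interimAlloc i
  have hUm : Measurable U := hM.measurable.measurable_truthfulUtility i
  have hU0 : ∀ z ∈ (F i).types, 0 ≤ U z := fun z hz => hM.truthfulUtility_nonneg hC hz
  have hUx : ∀ z ∈ (F i).types, U z / C ≤ x z := fun z hz => hM.truthfulUtility_le hC hz
  have hx1 : ∀ z, x z ≤ 1 := fun z => hM.measurable.interimAlloc_le_one i z
  have hx0 : ∀ z, 0 ≤ x z := fun z => interimAlloc_nonneg i z
  have hpos : Integrable (fun v => max ((F i).virtualValue v) 0) (F i).law :=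
    ((F i).integrable_virtualValue hmean).pos_part
  have hexc : Integrable (fun v => max (v - C) 0) (F i).law :=
    (hmean.sub (integrable_const C)).pos_part
  have ipx := hM.measurable.integrable_mul_interimAlloc i hpos
  have iex := hM.measurable.integrable_mul_interimAlloc i hexc
  obtain ⟨v1, v2, v3⟩ := (F i).integral_virtualValue_mul (y := fun z => x z + U z / C) (B := 2)
    hmean (hxm.add (hUm.div_const C))
    (fun v hv => add_nonneg (hx0 v) (div_nonneg (hU0 v hv) hC.le))
    (fun v hv => by linarith [hUx v hv, hx1 v])
  have e1 : ∫ q, (q.2 i * M.alloc q.1 q.2 i - M.cappedUtility C i (q.2 i) (q.2 i) q) ∂M.jointLaw F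
      = ∫ v, (v * x v - U v) ∂(F i).law := by
    rw [M.integral_eq_integral_interim F i isub]
    refine integral_congr_ae ?_
    filter_upwards [(F i).law_types] with v hv
    simp only [Function.update_self]
    have : ∀ q : R × (Fin n → ℝ), M.cappedUtility C i v v (q.1, Function.update q.2 i v)
        = M.cappedUtility C i v v q := fun q => by simp [cappedUtility]
    simp_rw [this]
    rw [integral_sub ((hM.measurable.integrable_alloc_update i v).const_mul v)
      (hM.integrable_cappedUtility hC hv le_rfl), integral_const_mul]
    rfl
  have iU : Integrable U (F i).law := by
    refine Integrable.of_bound hUm.aestronglyMeasurable C ?_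
    filter_upwards [(F i).law_types] with v hv
    rw [Real.norm_of_nonneg (hU0 v hv)]
    exact (div_le_one hC).1 ((hUx v hv).trans (hx1 v))
  rw [e1]
  calc ∫ v, (v * x v - U v) ∂(F i).law
      ≤ ∫ v, ((v * (x v + U v / C) - ∫ z in (0 : ℝ)..v,
          (F i).types.indicator (fun z => x z + U z / C) z) + max (v - C) 0 * x v) ∂(F i).law := by
        refine integral_mono_ae ((hM.measurable.integrable_mul_interimAlloc i hmean).sub iU)
          (v2.add iex) ?_
        filter_upwards [(F i).law_types] with v hv
        exact hM.mul_interimAlloc_sub_truthfulUtility_le hC hv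
    _ = ∫ v, (F i).virtualValue v * (x v + U v / C) ∂(F i).law
          + ∫ v, max (v - C) 0 * x v ∂(F i).law := by rw [integral_add v2 iex, v3]
    _ ≤ 2 * (∫ v, max ((F i).virtualValue v) 0 * x v ∂(F i).law)
          + ∫ v, max (v - C) 0 * x v ∂(F i).law := by
        refine add_le_add ?_ le_rfl
        rw [← integral_const_mul]
        refine integral_mono_ae v1 (ipx.const_mul 2) ?_
        filter_upwards [(F i).law_types] with v hv
        have h1 : 0 ≤ x v + U v / C := add_nonneg (hx0 v) (div_nonneg (hU0 v hv) hC.le)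
        calc (F i).virtualValue v * (x v + U v / C)
            ≤ max ((F i).virtualValue v) 0 * (x v + U v / C) :=
              mul_le_mul_of_nonneg_right (le_max_left _ _) h1
          _ ≤ max ((F i).virtualValue v) 0 * (2 * x v) :=
              mul_le_mul_of_nonneg_left (by linarith [hUx v hv]) (le_max_right _ _)
          _ = 2 * (max ((F i).virtualValue v) 0 * x v) := by ring

end Mechanism

/-- The better of the two auctions is a 3-approximation for capacitated bidders. -/
theorem capacitated_revenue_le (hF : ∀ i, (F i).IsRegular) (hC : 0 < C)
    (hM : M.IsAuction F (capUtility C)) :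
    M.revenue F
      ≤ 3 * max ((myersonAuction F).revenue F) ((capacitatedSecondPrice n C).revenue F) := by
  by_cases htop : (capacitatedSecondPrice n C).revenue F = ⊤
  · rw [htop, max_eq_right le_top, EReal.mul_top_of_pos (by norm_num)]
    exact le_top
  have hi := integrable_of_capacitatedSecondPrice_revenue_ne_top htop
  have hmean := integrable_id_of_integrable_pay hC hi
  have hone := fun i => hM.integral_surplus_sub_utility_le hC i (hmean i)
  have hrn := sum_integral_virtualValue_le hF hmean hM.measurable
  have hcsp := sum_integral_sub_capacity_le hC hi hM.measurable
  rw [myersonAuction_revenue hF hmean, capacitatedSecondPrice_revenue hi]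
  -- The payments of `M` are not bounded below and need not be integrable; the dominating integrand
  -- is.
  have h1 : M.revenue F ≤ eexpect (M.jointLaw F) fun q => ∑ i, (q.2 i * M.alloc q.1 q.2 i
      - M.cappedUtility C i (q.2 i) (q.2 i) q) := by
    refine eexpect_mono (ae_of_all _ fun q => Finset.sum_le_sum fun i _ => ?_)
    have : M.cappedUtility C i (q.2 i) (q.2 i) q
        ≤ q.2 i * M.alloc q.1 q.2 i - M.pay q.1 q.2 i := by
      simp only [Mechanism.cappedUtility, Function.update_eq_self]
      exact min_le_left _ _
    linarith
  rw [eexpect_eq_integral (integrable_finsetSum _ fun i _ => (hone i).1),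
    integral_finsetSum _ fun i _ => (hone i).1] at h1
  refine h1.trans ?_
  have h2 := Finset.sum_le_sum fun i (_ : i ∈ Finset.univ) => (hone i).2
  rw [Finset.sum_add_distrib, ← Finset.mul_sum] at h2
  set a := ∫ b, optimalVirtualSurplus F b ∂valueLaw F
  set b := ∫ b, ∑ j, (capacitatedSecondPrice n C).pay () b j ∂valueLaw F
  have h3 : (3 : EReal) * max (a : EReal) (b : EReal) = ((3 * max a b : ℝ) : EReal) := by
    rw [EReal.coe_mul, EReal.coe_strictMono.monotone.map_max]
    rfl
  rw [h3, EReal.coe_le_coe_iff]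
  linarith [le_max_left a b, le_max_right a b]

end Capacitated

/-! ### Optimality for risk-neutral bidders -/

section RiskNeutral

variable {n : ℕ} {R : Type*} [MeasurableSpace R] {M : Mechanism n R} {F : Fin n → ValueDistribution}

namespace Mechanism

/-- In an auction for risk-neutral bidders with integrable payments, all interim payments are
finite. -/
theorem IsAuction.integrable_pay_update (hM : M.IsAuction F riskNeutralUtility) {i : Fin n}
    (hp : Integrable (fun q => M.pay q.1 q.2 i) (M.jointLaw F)) {z : ℝ} (hz : z ∈ (F i).types) :
    Integrable (fun q => M.pay q.1 (Function.update q.2 i z) i) (M.jointLaw F) := by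
  -- Fubini provides one type `v` with integrable payment. Her truthful utility is finite and bounds
  -- that of the report `z`, whose integrand is bounded below by `(v - z) * alloc`; so the payment
  -- for `z` is integrable too.
  obtain ⟨v, hvi, hv⟩ :=
    ((M.integrable_comp_replaceReport F i hp).prod_right_ae.and (F i).law_types).exists
  have ia := fun z => hM.measurable.integrable_alloc_update (F := F) i z
  have iu : Integrable (fun q => v * M.alloc q.1 (Function.update q.2 i v) i
      - M.pay q.1 (Function.update q.2 i v) i) (M.jointLaw F) := ((ia v).const_mul v).sub hvi
  have h1 : M.interimUtility F riskNeutralUtility i v z ≠ ⊤ := by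
    refine ((hM.bic i v hv z hz).trans_lt ?_).ne
    have := eexpect_eq_integral iu
    simp only [interimUtility, riskNeutralUtility]
    rw [this]
    exact EReal.coe_lt_top _
  have h2 : Integrable (fun q => v * M.alloc q.1 (Function.update q.2 i z) i
      - M.pay q.1 (Function.update q.2 i z) i) (M.jointLaw F) := by
    refine integrable_of_eexpect_ne_top
      (((hM.measurable.alloc_update i z).const_mul v).sub
        (hM.measurable.pay_update i z)).aestronglyMeasurable
      ((ia z).const_mul (v - z)) ?_ h1
    filter_upwards [M.ae_mem_types F] with q hq
    have := hM.exPostIR.pay_le q.1 (update_mem_types hq hz) i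
    simp only [Function.update_self] at this
    linarith
  refine (((ia z).const_mul v).sub h2).congr (ae_of_all _ fun q => ?_)
  simp

/-- The envelope argument: incentive compatibility makes interim utility grow at least at rate x, so
it is at least ∫ x, and the payment is at most the threshold payment for x. -/
theorem IsAuction.integral_pay_le (hM : M.IsAuction F riskNeutralUtility) {i : Fin n}
    (hmean : Integrable (fun v : ℝ => v) (F i).law)
    (hp : Integrable (fun q => M.pay q.1 q.2 i) (M.jointLaw F)) :
    ∫ q, M.pay q.1 q.2 i ∂M.jointLaw F
      ≤ ∫ v, max ((F i).virtualValue v) 0 * M.interimAlloc F i v ∂(F i).law := by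
  set x := M.interimAlloc F i with hx
  have hxm : Measurable x := hM.measurable.measurable_interimAlloc i
  have hx1 : ∀ z, x z ≤ 1 := fun z => hM.measurable.interimAlloc_le_one i z
  have hx0 : ∀ z, 0 ≤ x z := fun z => interimAlloc_nonneg i z
  have ia := fun z => hM.measurable.integrable_alloc_update (F := F) i z
  have ip : ∀ z ∈ (F i).types, _ := fun z hz => hM.integrable_pay_update hp hz
  set P : ℝ → ℝ := fun z => ∫ q, M.pay q.1 (Function.update q.2 i z) i ∂M.jointLaw F with hP
  have hu : ∀ v, ∀ z ∈ (F i).types, Integrable (fun q => v * M.alloc q.1 (Function.update q.2 i z) i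
      - M.pay q.1 (Function.update q.2 i z) i) (M.jointLaw F) ∧
      M.interimUtility F riskNeutralUtility i v z = ((v * x z - P z : ℝ) : EReal) := by
    intro v z hz
    have h : Integrable (fun q => v * M.alloc q.1 (Function.update q.2 i z) i
      - M.pay q.1 (Function.update q.2 i z) i) (M.jointLaw F) := ((ia z).const_mul v).sub (ip z hz)
    refine ⟨h, ?_⟩
    have e := eexpect_eq_integral h
    simp only [interimUtility, riskNeutralUtility]
    rw [e, integral_sub ((ia z).const_mul v) (ip z hz), integral_const_mul]
    rfl
  have hbic : ∀ v ∈ (F i).types, ∀ z ∈ (F i).types, v * x z - P z ≤ v * x v - P v := by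
    intro v hv z hz
    have h := hM.bic i v hv z hz
    rwa [(hu v z hz).2, (hu v v hv).2, EReal.coe_le_coe_iff] at h
  have hU0 : ∀ v ∈ (F i).types, 0 ≤ v * x v - P v := by
    intro v hv
    have : P v ≤ v * x v := by
      rw [hx, interimAlloc, ← integral_const_mul]
      refine integral_mono_ae (ip v hv) ((ia v).const_mul v) ?_
      filter_upwards [M.ae_mem_types F] with q hq
      simpa using hM.exPostIR.pay_le q.1 (update_mem_types hq hv) i
    linarith
  have hpay : ∀ v ∈ (F i).types, P v ≤ v * x v - ∫ z in (0 : ℝ)..v, (F i).types.indicator x z := by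
    intro v hv
    -- The capacity 1 is arbitrary: truncating the increment only weakens the hypothesis to be
    -- checked.
    have h := integral_le_sub_of_add_mul_min_le
      (U := (F i).types.indicator fun v => v * x v - P v) (g := (F i).types.indicator x)
      (B := 1) ((F i).types_nonneg v hv) zero_lt_one
      (hxm.indicator (F i).measurableSet_types)
      (fun z _ => Set.indicator_nonneg (fun z _ => hx0 z) z)
      (fun z _ => Set.indicator_le' (fun z _ => hx1 z) (fun _ _ => zero_le_one) z)
      (fun s t _ hst htv => by
        by_cases hs : s ∈ (F i).types
        · have ht : t ∈ (F i).types := (F i).types_ordConnected.out hs hv ⟨hst, htv⟩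
          rw [Set.indicator_of_mem hs, Set.indicator_of_mem hs, Set.indicator_of_mem ht]
          have h1 := hbic t ht s hs
          have h2 := mul_le_mul_of_nonneg_left (min_le_left (t - s) 1) (hx0 s)
          linarith
        · rw [Set.indicator_of_notMem hs, Set.indicator_of_notMem hs, zero_mul, add_zero]
          exact Set.indicator_nonneg hU0 t)
    rw [Set.indicator_of_mem hv] at h
    have h0 : 0 ≤ (F i).types.indicator (fun v => v * x v - P v) 0 := Set.indicator_nonneg hU0 0
    linarith
  obtain ⟨v1, v2, v3⟩ := (F i).integral_virtualValue_mul (y := x) (B := 1) hmean hxm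
    (fun v _ => hx0 v) (fun v _ => hx1 v)
  have iP : Integrable P (F i).law := (M.integrable_comp_replaceReport F i hp).integral_prod_left
  rw [M.integral_eq_integral_interim F i hp]
  calc ∫ v, P v ∂(F i).law
      ≤ ∫ v, (v * x v - ∫ z in (0 : ℝ)..v, (F i).types.indicator x z) ∂(F i).law := by
        refine integral_mono_ae iP v2 ?_
        filter_upwards [(F i).law_types] with v hv using hpay v hv
    _ = ∫ v, (F i).virtualValue v * x v ∂(F i).law := v3.symm
    _ ≤ _ := integral_mono v1 (hM.measurable.integrable_mul_interimAlloc i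
        ((F i).integrable_virtualValue hmean).pos_part)
        fun v => mul_le_mul_of_nonneg_right (le_max_left _ _) (hx0 v)

end Mechanism

/-- Optimality of the auction that maximizes the virtual surplus, for risk-neutral bidders. -/
theorem riskNeutral_revenue_le (hF : ∀ i, (F i).IsRegular)
    (hmean : ∀ i, Integrable (fun v : ℝ => v) (F i).law)
    (hM : M.IsAuction F riskNeutralUtility) : M.revenue F ≤ (myersonAuction F).revenue F := by
  -- The total payment is at most the sum of the values, which is integrable, so revenue `⊥` is the
  -- only way for it to fail to be integrable.
  by_cases hbot : M.revenue F = ⊥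
  · rw [hbot]
    exact bot_le
  have hsm : Measurable fun q : R × (Fin n → ℝ) => ∑ i, M.pay q.1 q.2 i :=
    Finset.measurable_fun_sum _ fun i _ => (hM.measurable i).2
  have hs : Integrable (fun q => ∑ i, M.pay q.1 q.2 i) (M.jointLaw F) := by
    refine integrable_of_eexpect_ne_bot hsm.aestronglyMeasurable
      (integrable_finsetSum Finset.univ fun i _ => Mechanism.integrable_value i (hmean i)) ?_ hbot
    filter_upwards [M.ae_mem_types F] with q hq
    exact hM.exPostIR.sum_pay_le q.1 hq
  have hp : ∀ i, Integrable (fun q => M.pay q.1 q.2 i) (M.jointLaw F) := fun i => by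
    refine hs.mono (hM.measurable i).2.aestronglyMeasurable ?_
    filter_upwards [M.ae_mem_types F] with q hq
    exact hM.exPostIR.abs_pay_le q.1 hq i
  rw [myersonAuction_revenue hF hmean, Mechanism.revenue, eexpect_eq_integral hs,
    EReal.coe_le_coe_iff, integral_finsetSum _ fun i _ => hp i]
  exact (Finset.sum_le_sum fun i _ => hM.integral_pay_le (hmean i) (hp i)).trans
    (sum_integral_virtualValue_le hF hmean hM.measurable)

end RiskNeutral

end

theorem corollary4p2 {n : ℕ} (F : Fin n → ValueDistribution) (hF : ∀ i, (F i).IsRegular)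
    (C : ℝ) (hC : 0 < C) :
    -- truthtelling is an equilibrium of both auctions, for capacitated bidders
    (myersonAuction F).IsAuction F (capUtility C) ∧
    (capacitatedSecondPrice n C).IsAuction F (capUtility C) ∧
    -- the first of them is the revenue-optimal auction for risk-neutral bidders
    (myersonAuction F).IsAuction F riskNeutralUtility ∧
    ((∀ i, Integrable (fun v : ℝ => v) (F i).law) →
      ∀ (R : Type*) [MeasurableSpace R] (M : Mechanism n R),
        M.IsAuction F riskNeutralUtility → M.revenue F ≤ (myersonAuction F).revenue F) ∧
    -- the better of the two is a 3-approximation for capacitated bidders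
    ∀ (R : Type*) [MeasurableSpace R] (M : Mechanism n R),
      M.IsAuction F (capUtility C) →
        M.revenue F ≤
          3 * max ((myersonAuction F).revenue F) ((capacitatedSecondPrice n C).revenue F) :=
  ⟨myersonAuction_isAuction hF fun _ _ h => min_le_min_right C h,
    capacitatedSecondPrice_isAuction hC,
    myersonAuction_isAuction hF monotone_id,
    fun hmean _ _ _ hM => riskNeutral_revenue_le hF hmean hM,
    fun _ _ _ hM => capacitated_revenue_le hF hC hM⟩
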